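/- Let $\rho:\mathbb{R}^m\to[0,\infty)$ be a bounded probability density which is positive on $\mathcal{X}\subseteq\mathbb{R}^m$ and zero off $\mathcal{X}$; $\mathbb{E}$ denotes expectation with respect to $\rho$. Rotated coordinates. For an orthogonal $m\times m$ matrix $V=[V_1\;V_2]$ with $V_1$ consisting of the first $n<m$ columns, write $y=V_1^Tx\in\mathbb{R}^n$ and $z=V_2^Tx\in\mathbb{R}^{m-n}$. The joint density of $(y,z)$ is $\pi(y,z)=\rho(V_1y+V_2z)$, with marginal $\pi_Y(y)=\int\pi(y,z)\,dz$ and conditional density $\pi_{Z|Y}(z|y)=\pi(y,z)/\pi_Y(y)$. Poincaré constant. A function is called absolutely continuous on a set if it is absolutely continuous along every line segment contained in the set and differentiable at almost every point of the set. Let $C_1=C_1(\mathcal{X},\rho)\in[0,\infty]$ be the infimum of the constants $c$ such that, for all $n<m$, all orthogonal $V$ and almost every $y$, the conditional density $\pi_{Z|Y}(\cdot|y)$ on the slice $\{z: V_1y+V_2z\in\mathcal{X}\}$ satisfies the Poincaré inequality $\mathrm{Var}(g)\le c\int|\nabla g(z)|^2\pi_{Z|Y}(z|y)\,dz$ for all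 $g$ that are absolutely continuous on the slice and for which $g$ and $\nabla g$ are square integrable with respect to $\pi_{Z|Y}(\cdot|y)$. Thus $C_1$ depends only on $\mathcal{X}$ and $\rho$. (1) Suppose $C_1<\infty$. Let $f$ be absolutely continuous on $\mathcal{X}$ and square integrable with respect to $\rho$, with $\rho$-integrable products of partial derivatives. Let $C=\mathbb{E}[(\nabla f)(\nabla f)^T]=W\,\mathrm{diag}(\lambda_1,\dots,\lambda_m)\,W^T$ with $W$ orthogonal and $\lambda_1\ge\dots\ge\lambda_m$. Let $\varepsilon>0$ and let $\tilde W=[\tilde W_1\;\tilde W_2]$ be an orthogonal matrix with $\|W-\tilde W\|\le\varepsilon$ in the matrix 2-norm, the sign of each column $\tilde w_i$ being chosen to minimize $\|w_i-\tilde w_i\|$. For $0\le n<m$ and $N\ge1$ let $$\hat F_\varepsilon(x)=\frac1N\sum_{i=1}^N f(\tilde W_1\tilde y+\tilde W_2\tilde z_i),\qquad \tilde y=\tilde W_1^Tx,$$ where, given $x$, the $\tilde z_i$ are drawn independently from the conditional density $\tilde\pi_{\tilde Z|\tilde Y}(\cdot|\tilde y)$ belonging to $V=\tilde W$. Then $(f-\hat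 F_\varepsilon)^2$ is integrable with respect to the joint law of $x\sim\rho$ and the samples, and $$\mathbb{E}\big[(f-\hat F_\varepsilon)^2\big]\le C_1\Big(1+\frac1N\Big)\Big(\varepsilon(\lambda_1+\dots+\lambda_n)^{1/2}+(\lambda_{n+1}+\dots+\lambda_m)^{1/2}\Big)^2 .$$ (2) $C_1<\infty$ holds in each of the following cases: (a) $\mathcal{X}$ is bounded and convex and $\rho\ge c$ on $\mathcal{X}$ for some $c>0$ (for example the uniform density on a hypercube); (b) $\mathcal{X}=\mathbb{R}^m$ and $c_1e^{-\kappa|x|^2}\le\rho(x)\le c_2e^{-\kappa|x|^2}$ for some $\kappa,c_1,c_2>0$ (for example the standard Gaussian density). -/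

import Mathlib

open MeasureTheory ProbabilityTheory
open scoped ENNReal Gradient

noncomputable section

namespace ActiveSubspace

/-- The index set of the first `n` of the `m` rotated coordinates. -/
abbrev ActiveIdx (m n : ℕ) : Type := {i : Fin m // i.val < n}

/-- The index set of the last `m - n` of the `m` rotated coordinates. -/
abbrev InactiveIdx (m n : ℕ) : Type := {i : Fin m // n ≤ i.val}

/-! ### The weight and the functions -/

/-- `ρ` is a bounded probability density on `ℝ^m`, positive exactly on `X`. -/
structure IsWeight {m : ℕ} (X : Set (EuclideanSpace ℝ (Fin m)))
    (ρ : EuclideanSpace ℝ (Fin m) → ℝ) : Prop where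
  measurable : Measurable ρ
  pos : ∀ x ∈ X, 0 < ρ x
  zero : ∀ x ∉ X, ρ x = 0
  bounded : ∃ B : ℝ, ∀ x, ρ x ≤ B
  mass : ∫⁻ x, ENNReal.ofReal (ρ x) = 1

/-- The probability measure on `ℝ^m` with density `ρ`. -/
def weightMeasure {m : ℕ} (ρ : EuclideanSpace ℝ (Fin m) → ℝ) :
    Measure (EuclideanSpace ℝ (Fin m)) :=
  volume.withDensity fun x => ENNReal.ofReal (ρ x)

/-- `g` is absolutely continuous on `S`: it is absolutely continuous along every line segment
contained in `S`, and it has a gradient at almost every point of `S`. -/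
structure IsAbsCont {ι : Type*} [Fintype ι] (g : EuclideanSpace ℝ ι → ℝ)
    (S : Set (EuclideanSpace ℝ ι)) : Prop where
  along_segments : ∀ a b, segment ℝ a b ⊆ S →
    AbsolutelyContinuousOnInterval (fun t : ℝ => g (AffineMap.lineMap a b t)) 0 1
  differentiable : ∀ᵐ x, x ∈ S → DifferentiableAt ℝ g x

/-- The admissible functions: absolutely continuous on `X`, square integrable with respect to `ρ`,
and such that the products of the partial derivatives are integrable with respect to `ρ`. -/
structure IsAdmissible {m : ℕ} (X : Set (EuclideanSpace ℝ (Fin m)))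
    (ρ : EuclideanSpace ℝ (Fin m) → ℝ) (f : EuclideanSpace ℝ (Fin m) → ℝ) : Prop where
  absCont : IsAbsCont f X
  memLp : MemLp f 2 (weightMeasure ρ)
  integrable : ∀ i j, Integrable (fun x => (∇ f x) i * (∇ f x) j) (weightMeasure ρ)

/-- The matrix `C = 𝔼[(∇f)(∇f)ᵀ]`. -/
def gradMatrix {m : ℕ} (ρ f : EuclideanSpace ℝ (Fin m) → ℝ) : Matrix (Fin m) (Fin m) ℝ :=
  Matrix.of fun i j => ∫ x, (∇ f x) i * (∇ f x) j ∂(weightMeasure ρ)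

/-- `C = W diag(lam) Wᵀ` with `W` orthogonal and the eigenvalues `lam` in decreasing order. -/
structure IsEigendecomposition {m : ℕ} (C W : Matrix (Fin m) (Fin m) ℝ) (lam : Fin m → ℝ) :
    Prop where
  orthogonal : W ∈ Matrix.orthogonalGroup (Fin m) ℝ
  antitone : Antitone lam
  eq : C = W * Matrix.diagonal lam * W.transpose

/-- The orthogonal matrix `W'` is an `ε`-perturbation of `W`: the sign of each column of `W'` is
the one that brings it closest to the column of `W`, and `‖W - W'‖ ≤ ε` in the matrix 2-norm. -/
structure IsPerturbation {m : ℕ} (W W' : Matrix (Fin m) (Fin m) ℝ) (ε : ℝ) : Prop where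
  orthogonal : W' ∈ Matrix.orthogonalGroup (Fin m) ℝ
  sign : ∀ i, ‖WithLp.toLp 2 (W.col i - W'.col i)‖ ≤ ‖WithLp.toLp 2 (W.col i + W'.col i)‖
  norm_le : ‖Matrix.toEuclideanCLM (𝕜 := ℝ) (W - W')‖ ≤ ε

/-! ### Rotated coordinates and conditional densities -/

/-- The first `n` columns `W₁` of `W`. -/
def firstCols {m : ℕ} (W : Matrix (Fin m) (Fin m) ℝ) (n : ℕ) :
    Matrix (Fin m) (ActiveIdx m n) ℝ :=
  W.submatrix id Subtype.val

/-- The last `m - n` columns `W₂` of `W`. -/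
def lastCols {m : ℕ} (W : Matrix (Fin m) (Fin m) ℝ) (n : ℕ) :
    Matrix (Fin m) (InactiveIdx m n) ℝ :=
  W.submatrix id Subtype.val

/-- The coordinates `y = W₁ᵀ x`. -/
def activeCoord {m : ℕ} (W : Matrix (Fin m) (Fin m) ℝ) (n : ℕ)
    (x : EuclideanSpace ℝ (Fin m)) : EuclideanSpace ℝ (ActiveIdx m n) :=
  WithLp.toLp 2 ((firstCols W n).transpose.mulVec x.ofLp)

/-- The point `W₁ y + W₂ z` of `ℝ^m`. -/
def fromCoords {m : ℕ} (W : Matrix (Fin m) (Fin m) ℝ) (n : ℕ)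
    (y : EuclideanSpace ℝ (ActiveIdx m n)) (z : EuclideanSpace ℝ (InactiveIdx m n)) :
    EuclideanSpace ℝ (Fin m) :=
  WithLp.toLp 2 ((firstCols W n).mulVec y.ofLp + (lastCols W n).mulVec z.ofLp)

/-- The joint density `π(y, z) = ρ(W₁ y + W₂ z)`. -/
def jointDensity {m : ℕ} (W : Matrix (Fin m) (Fin m) ℝ) (n : ℕ)
    (ρ : EuclideanSpace ℝ (Fin m) → ℝ)
    (y : EuclideanSpace ℝ (ActiveIdx m n)) (z : EuclideanSpace ℝ (InactiveIdx m n)) : ℝ≥0∞ :=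
  ENNReal.ofReal (ρ (fromCoords W n y z))

/-- The marginal density `π_Y(y) = ∫ π(y, z) dz`. -/
def marginalDensity {m : ℕ} (W : Matrix (Fin m) (Fin m) ℝ) (n : ℕ)
    (ρ : EuclideanSpace ℝ (Fin m) → ℝ) (y : EuclideanSpace ℝ (ActiveIdx m n)) : ℝ≥0∞ :=
  ∫⁻ z, jointDensity W n ρ y z

/-- The conditional density `π_{Z|Y}(z | y) = π(y, z) / π_Y(y)`. -/
def condDensity {m : ℕ} (W : Matrix (Fin m) (Fin m) ℝ) (n : ℕ)
    (ρ : EuclideanSpace ℝ (Fin m) → ℝ)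
    (y : EuclideanSpace ℝ (ActiveIdx m n)) (z : EuclideanSpace ℝ (InactiveIdx m n)) : ℝ≥0∞ :=
  jointDensity W n ρ y z / marginalDensity W n ρ y

/-- The conditional distribution of `z` given `y`. -/
def condMeasure {m : ℕ} (W : Matrix (Fin m) (Fin m) ℝ) (n : ℕ)
    (ρ : EuclideanSpace ℝ (Fin m) → ℝ) (y : EuclideanSpace ℝ (ActiveIdx m n)) :
    Measure (EuclideanSpace ℝ (InactiveIdx m n)) :=
  volume.withDensity (condDensity W n ρ y)

/-! ### The Poincaré constant -/

/-- The measure `μ` on `S` satisfies the Poincaré inequality `Var_μ(g) ≤ c ∫ |∇g|² dμ`, for all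
absolutely continuous `g` on `S` such that `g` and `∇g` are square integrable. -/
def SatisfiesPoincare {ι : Type*} [Fintype ι] (S : Set (EuclideanSpace ℝ ι))
    (μ : Measure (EuclideanSpace ℝ ι)) (c : ℝ≥0∞) : Prop :=
  ∀ g : EuclideanSpace ℝ ι → ℝ, IsAbsCont g S → MemLp g 2 μ → MemLp (∇ g) 2 μ →
    evariance g μ ≤ c * ∫⁻ z, ‖∇ g z‖ₑ ^ 2 ∂μ

/-- The Poincaré constant of `(X, ρ)`, possibly infinite: the least `c` that serves in the
Poincaré inequality of the conditional densities of `ρ` on (almost) all slices of `X` by affine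
subspaces of dimension `m - n`, for all `n < m` and all orthogonal coordinate systems. It depends
only on `X` and `ρ`. -/
def poincareConstant {m : ℕ} (X : Set (EuclideanSpace ℝ (Fin m)))
    (ρ : EuclideanSpace ℝ (Fin m) → ℝ) : ℝ≥0∞ :=
  sInf {c : ℝ≥0∞ | ∀ n < m, ∀ W ∈ Matrix.orthogonalGroup (Fin m) ℝ,
    ∀ᵐ y : EuclideanSpace ℝ (ActiveIdx m n),
      SatisfiesPoincare {z | fromCoords W n y z ∈ X} (condMeasure W n ρ y) c}

/-! ### The Monte Carlo approximation -/

/-- The Monte Carlo approximation `F̂(x) = N⁻¹ ∑ᵢ f(W₁ y + W₂ zᵢ)` with `y = W₁ᵀ x`, as a function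
of `x` and of the samples `z₁, …, z_N`. -/
def monteCarlo {m : ℕ} (W : Matrix (Fin m) (Fin m) ℝ) (n N : ℕ)
    (f : EuclideanSpace ℝ (Fin m) → ℝ) (x : EuclideanSpace ℝ (Fin m))
    (z : Fin N → EuclideanSpace ℝ (InactiveIdx m n)) : ℝ :=
  (1 / (N : ℝ)) * ∑ i, f (fromCoords W n (activeCoord W n x) (z i))

/-- The joint law of `x` and of the samples: `x` has density `ρ` and, given `x`, the samples
`z₁, …, z_N` are independent with density `π_{Z|Y}(· | W₁ᵀ x)`. -/
def sampleLaw {m : ℕ} (W : Matrix (Fin m) (Fin m) ℝ) (n N : ℕ)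
    (ρ : EuclideanSpace ℝ (Fin m) → ℝ) :
    Measure (EuclideanSpace ℝ (Fin m) × (Fin N → EuclideanSpace ℝ (InactiveIdx m n))) :=
  volume.withDensity fun p =>
    ENNReal.ofReal (ρ p.1) * ∏ i, condDensity W n ρ (activeCoord W n p.1) (p.2 i)

end ActiveSubspace

end

noncomputable section

namespace ActiveSubspace

/-! ### Poincaré inequalities from segments -/

/-! Error bound. Write x = W̃₁y + W̃₂z₀. Given y, the point z₀ and the samples z₁, …, z_N are
independent with the same conditional law, so the conditional mean squared error is exactly (1 +
1/N) times the conditional variance of z ↦ f(W̃₁y + W̃₂z) (`lintegral_sampleLaw`,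
`lintegral_sub_sampleMean_sq`). The gradient of this slice function is W̃₂ᵀ∇f, so the Poincaré
inequality and integration over y bound the error by C₁(1 + 1/N) 𝔼|W̃₂ᵀ∇f|². The last expectation is
the trace of W̃₂ᵀCW̃₂. In the eigenbasis of C it equals ∑ₗ λₗ ∑ⱼ (wₗ·w̃ⱼ)² with j over the inactive
columns. The inner sum is at most 1 by Bessel. For active l it is at most ε², since wₗ may be
replaced by wₗ - w̃ₗ (`IsPerturbation.sum_inactive_le`).

Finiteness of C₁. The variance is at most the double integral of |g(y) - g(x)|², and each difference
is the integral of a directional derivative along the segment from x to y. By symmetry only the half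
of the segment nearer x matters. There the substitution u = (1 - t)x + ty has Jacobian bounded
below, and the estimate reduces to a bound, at each u, on the weighted family of segments through u
(`satisfiesPoincare_of_segment_bound`). For bounded convex sets this follows from the diameter and
the oscillation of the density, for Gaussian-like densities from an inequality between exponents.
Since `fromCoords` is an isometry, slices inherit the hypotheses with constants that depend neither
on the rotation nor on y. -/

theorem sq_lintegral_le_lintegral_sq {α : Type*} [MeasurableSpace α] {μ : Measure α}
    [IsProbabilityMeasure μ] {f : α → ℝ≥0∞} (hf : AEMeasurable f μ) :
    (∫⁻ a, f a ∂μ) ^ 2 ≤ ∫⁻ a, f a ^ 2 ∂μ := by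
  have h := ENNReal.lintegral_mul_le_Lp_mul_Lq μ Real.HolderConjugate.two_two hf
    (aemeasurable_const (b := (1 : ℝ≥0∞)))
  simp only [Pi.mul_apply, mul_one, ENNReal.one_rpow, lintegral_const, measure_univ] at h
  have h2 := pow_le_pow_left₀ zero_le h 2
  rwa [← ENNReal.rpow_natCast _ 2, ← ENNReal.rpow_natCast _ 2, ← ENNReal.rpow_mul,
    Nat.cast_ofNat, show (1 / 2 : ℝ) * 2 = 1 by norm_num, ENNReal.rpow_one,
    ENNReal.rpow_ofNat, lintegral_congr fun a => ENNReal.rpow_ofNat (f a) 2] at h2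

/-- Jensen's inequality: g(x) minus its mean is the average over y of g(x) - g(y). The sharp factor
1/2 is given away. -/
theorem evariance_le_lintegral_lintegral {α : Type*} [MeasurableSpace α] {μ : Measure α}
    [IsProbabilityMeasure μ] {g : α → ℝ} (hg : MemLp g 2 μ) :
    evariance g μ ≤ ∫⁻ x, ∫⁻ y, ‖g y - g x‖ₑ ^ 2 ∂μ ∂μ := by
  refine lintegral_mono fun x => ?_
  have hi : Integrable g μ := hg.integrable (by norm_num)
  have h : g x - μ[g] = -∫ y, (g y - g x) ∂μ := by
    rw [integral_sub hi (integrable_const _)]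
    simp
  rw [h, enorm_neg]
  refine (pow_le_pow_left₀ zero_le (enorm_integral_le_lintegral_enorm _) 2).trans ?_
  exact sq_lintegral_le_lintegral_sq
    (hg.aestronglyMeasurable.aemeasurable.sub aemeasurable_const).enorm

section Segments

variable {ι : Type*} [Fintype ι]

/-- The fundamental theorem of calculus along the segment, with Cauchy–Schwarz for the directional
derivative. The majorant `G` allows ‖∇g‖ to be replaced later by a measurable representative. -/
theorem IsAbsCont.enorm_sub_le {g : EuclideanSpace ℝ ι → ℝ} {S : Set (EuclideanSpace ℝ ι)}
    (hg : IsAbsCont g S) {a b : EuclideanSpace ℝ ι} (hab : segment ℝ a b ⊆ S)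
    {G : EuclideanSpace ℝ ι → ℝ≥0∞}
    (hG : ∀ᵐ t : ℝ ∂volume.restrict (Set.Ioc 0 1),
      DifferentiableAt ℝ g (AffineMap.lineMap a b t) ∧
        ‖∇ g (AffineMap.lineMap a b t)‖ₑ ≤ G (AffineMap.lineMap a b t)) :
    ‖g b - g a‖ₑ ≤ ‖b - a‖ₑ * ∫⁻ t in Set.Ioc (0 : ℝ) 1, G (AffineMap.lineMap a b t) := by
  have h := (hg.along_segments a b hab).integral_deriv_eq_sub
  simp only [AffineMap.lineMap_apply_one, AffineMap.lineMap_apply_zero] at h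
  rw [← h, intervalIntegral.integral_of_le zero_le_one,
    ← lintegral_const_mul' _ _ enorm_ne_top]
  refine (enorm_integral_le_lintegral_enorm _).trans (lintegral_mono_ae ?_)
  filter_upwards [hG] with t ht
  have hd : HasDerivAt (fun t : ℝ => g (AffineMap.lineMap a b t))
      (inner ℝ (∇ g (AffineMap.lineMap a b t)) (b - a)) t := by
    have h1 := ht.1.hasGradientAt.hasFDerivAt.comp_hasDerivAt t
      (AffineMap.hasDerivAt_lineMap (a := a) (b := b) (x := t))
    refine HasDerivAt.congr_deriv h1 ?_
    simp
  rw [hd.deriv, mul_comm]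
  refine le_trans ?_ (mul_le_mul_left ht.2 _)
  rw [← enorm_norm (∇ g _), ← enorm_norm (b - a), ← enorm_mul, enorm_le_iff_norm_le]
  simpa [abs_mul] using norm_inner_le_norm (𝕜 := ℝ) (∇ g (AffineMap.lineMap a b t)) (b - a)

theorem lintegral_comp_smul_add (F : EuclideanSpace ℝ ι → ℝ≥0∞) (hF : Measurable F) {r : ℝ}
    (hr : 0 < r) (v : EuclideanSpace ℝ ι) :
    ∫⁻ x, F (r • x + v) = ENNReal.ofReal ((r ^ Fintype.card ι)⁻¹) * ∫⁻ x, F x := by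
  have h1 := lintegral_map (μ := (volume : Measure (EuclideanSpace ℝ ι)))
    (f := fun x => F (x + v)) (by fun_prop) (measurable_const_smul r)
  rw [← h1, Measure.map_addHaar_smul _ hr.ne', lintegral_smul_measure,
    lintegral_add_right_eq_self, finrank_euclideanSpace, abs_of_pos (by positivity), smul_eq_mul]

theorem measurable_lineMap_uncurry :
    Measurable fun q : (EuclideanSpace ℝ ι × EuclideanSpace ℝ ι) × ℝ =>
      (AffineMap.lineMap q.1.1 q.1.2 q.2 : EuclideanSpace ℝ ι) := by
  simp only [AffineMap.lineMap_apply_module]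
  fun_prop

/-- For fixed y and t < 1 the map x ↦ (1 - t)x + ty is a homothety, so preimages of null sets are
null. Fubini then puts the quantifier over t innermost. The null set is first enlarged to a
measurable one. -/
theorem ae_ae_lineMap {P : EuclideanSpace ℝ ι → Prop} (hP : ∀ᵐ x, P x) :
    ∀ᵐ x, ∀ᵐ y, ∀ᵐ t : ℝ ∂volume.restrict (Set.Ioc 0 1), P (AffineMap.lineMap x y t) := by
  set N := toMeasurable (volume : Measure (EuclideanSpace ℝ ι)) {x | ¬ P x}
  have hN : MeasurableSet N := measurableSet_toMeasurable _ _
  have hN0 : (volume : Measure (EuclideanSpace ℝ ι)) N = 0 := by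
    rw [measure_toMeasurable]; exact hP
  have hPN : ∀ x, x ∉ N → P x := fun x hx => by
    by_contra h
    exact hx (subset_toMeasurable _ _ h)
  have hmeas : MeasurableSet {q : ℝ × (EuclideanSpace ℝ ι × EuclideanSpace ℝ ι) |
      (AffineMap.lineMap q.2.1 q.2.2 q.1 : EuclideanSpace ℝ ι) ∉ N} :=
    (measurable_lineMap_uncurry.comp measurable_swap) hN.compl
  have h1 : ∀ᵐ t : ℝ ∂volume.restrict (Set.Ioc 0 1),
      ∀ᵐ q : EuclideanSpace ℝ ι × EuclideanSpace ℝ ι,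
        (AffineMap.lineMap q.1 q.2 t : EuclideanSpace ℝ ι) ∉ N := by
    -- At t = 1 the point no longer depends on x and the homothety degenerates.
    have hne : ∀ᵐ t : ℝ ∂volume.restrict (Set.Ioc 0 1), t ≠ 1 :=
      ae_restrict_of_ae (measure_eq_zero_iff_ae_notMem.1 (measure_singleton (1 : ℝ)))
    filter_upwards [hne, ae_restrict_mem measurableSet_Ioc] with t ht1 ht
    have ht0 : 0 < 1 - t := sub_pos.2 (lt_of_le_of_ne ht.2 ht1)
    have hm : MeasurableSet {q : EuclideanSpace ℝ ι × EuclideanSpace ℝ ι |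
        (AffineMap.lineMap q.2 q.1 t : EuclideanSpace ℝ ι) ∉ N} :=
      (measurable_lineMap_uncurry.comp (measurable_swap.prodMk measurable_const)) hN.compl
    have h2 : ∀ᵐ q : EuclideanSpace ℝ ι × EuclideanSpace ℝ ι,
        (AffineMap.lineMap q.2 q.1 t : EuclideanSpace ℝ ι) ∉ N := by
      refine (Measure.ae_prod_mem_iff_ae_ae_mem hm).2 (ae_of_all _ fun y => ?_)
      have h3 := lintegral_comp_smul_add (N.indicator 1) (measurable_one.indicator hN) ht0 (t • y)
      rw [lintegral_indicator_one hN, hN0, mul_zero,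
        lintegral_eq_zero_iff (f := fun x => N.indicator 1 ((1 - t) • x + t • y))
          ((measurable_one.indicator hN).comp (by fun_prop))] at h3
      filter_upwards [h3] with x hx
      simp only [AffineMap.lineMap_apply_module]
      intro hmem
      simp [hmem] at hx
    exact (Measure.measurePreserving_swap (μ := (volume : Measure (EuclideanSpace ℝ ι)))
      (ν := (volume : Measure (EuclideanSpace ℝ ι)))).quasiMeasurePreserving.ae h2
  have h2 := (Measure.ae_ae_comm hmeas).1 h1
  filter_upwards [Measure.ae_ae_of_ae_prod h2] with x hx
  filter_upwards [hx] with y hy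
  filter_upwards [hy] with t ht using hPN _ ht

/-- Integrals over pairs of points, weighted along the segment joining them, are symmetric about
the midpoint. -/
theorem lintegral_segment_le_two_mul {p H : EuclideanSpace ℝ ι → ℝ≥0∞} (hp : Measurable p)
    (hH : Measurable H) :
    ∫⁻ x, ∫⁻ y, ∫⁻ t in Set.Ioc (0 : ℝ) 1,
        p x * p y * (‖y - x‖ₑ ^ 2 * H (AffineMap.lineMap x y t)) ≤
      2 * ∫⁻ x, ∫⁻ y, ∫⁻ t in Set.Ioc (0 : ℝ) (1 / 2),
        p x * p y * (‖y - x‖ₑ ^ 2 * H (AffineMap.lineMap x y t)) := by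
  set Φ : EuclideanSpace ℝ ι → EuclideanSpace ℝ ι → ℝ → ℝ≥0∞ := fun x y t =>
    p x * p y * (‖y - x‖ₑ ^ 2 * H (AffineMap.lineMap x y t)) with hΦ
  have hm : Measurable fun q : (EuclideanSpace ℝ ι × EuclideanSpace ℝ ι) × ℝ =>
      Φ q.1.1 q.1.2 q.2 := by
    have := hH.comp (measurable_lineMap_uncurry (ι := ι))
    simp only [hΦ]
    fun_prop
  have hmI : ∀ s : Set ℝ, Measurable fun q : EuclideanSpace ℝ ι × EuclideanSpace ℝ ι =>
      ∫⁻ t in s, Φ q.1 q.2 t := fun s => hm.lintegral_prod_right'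
  have hsplit : ∀ x y, ∫⁻ t in Set.Ioc (0 : ℝ) 1, Φ x y t ≤
      (∫⁻ t in Set.Ioc (0 : ℝ) (1 / 2), Φ x y t) + ∫⁻ t in Set.Ioc (0 : ℝ) (1 / 2), Φ y x t := by
    intro x y
    rw [← Set.Ioc_union_Ioc_eq_Ioc (b := (1 / 2 : ℝ)) (by norm_num) (by norm_num)]
    refine (lintegral_union_le _ _ _).trans (add_le_add_right ?_ _)
    have h1 := (Measure.measurePreserving_sub_left (volume : Measure ℝ) 1)
    have h2 := h1.setLIntegral_comp_preimage (s := Set.Ico (0 : ℝ) (1 / 2)) measurableSet_Ico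
      (f := fun t => Φ y x t) (hm.comp (f := fun t : ℝ => ((y, x), t)) (by fun_prop))
    have h3 : (fun t : ℝ => 1 - t) ⁻¹' Set.Ico 0 (1 / 2) = Set.Ioc (1 / 2) 1 := by
      ext t
      simp only [Set.mem_preimage, Set.mem_Ico, Set.mem_Ioc]
      constructor <;> rintro ⟨h, h'⟩ <;> constructor <;> linarith
    have h4 : ∀ t : ℝ, Φ y x (1 - t) = Φ x y t := by
      intro t
      simp only [hΦ, AffineMap.lineMap_apply_one_sub]
      rw [mul_comm (p y), ← enorm_neg (x - y), neg_sub]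
    rw [h3] at h2
    simp only [h4] at h2
    rw [h2, setLIntegral_congr Ico_ae_eq_Ioc]
  calc ∫⁻ x, ∫⁻ y, ∫⁻ t in Set.Ioc (0 : ℝ) 1, Φ x y t
      ≤ ∫⁻ x, ∫⁻ y, ((∫⁻ t in Set.Ioc (0 : ℝ) (1 / 2), Φ x y t) +
          ∫⁻ t in Set.Ioc (0 : ℝ) (1 / 2), Φ y x t) :=
        lintegral_mono fun x => lintegral_mono fun y => hsplit x y
    _ = ∫⁻ x, ((∫⁻ y, ∫⁻ t in Set.Ioc (0 : ℝ) (1 / 2), Φ x y t) +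
          ∫⁻ y, ∫⁻ t in Set.Ioc (0 : ℝ) (1 / 2), Φ y x t) :=
        lintegral_congr fun x =>
          lintegral_add_left ((hmI _).comp (measurable_const.prodMk measurable_id)) _
    _ = (∫⁻ x, ∫⁻ y, ∫⁻ t in Set.Ioc (0 : ℝ) (1 / 2), Φ x y t) +
          ∫⁻ x, ∫⁻ y, ∫⁻ t in Set.Ioc (0 : ℝ) (1 / 2), Φ y x t :=
        lintegral_add_left (hmI _).lintegral_prod_right' _
    _ = 2 * ∫⁻ x, ∫⁻ y, ∫⁻ t in Set.Ioc (0 : ℝ) (1 / 2), Φ x y t := by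
        rw [two_mul, lintegral_lintegral_swap (f := fun x y =>
          ∫⁻ t in Set.Ioc (0 : ℝ) (1 / 2), Φ y x t) 
          (show Measurable (Function.uncurry fun x y => ∫⁻ t in Set.Ioc (0 : ℝ) (1 / 2), Φ y x t)
            from (hmI _).comp measurable_swap).aemeasurable]

/-- Substitute u = (1 - t)x + ty for x. Since t ≤ 1/2, the Jacobian factor is at most 2^d, and y - x
= (1 - t)⁻¹(y - u) costs a further 4. In `hK` the starting point x of a segment through u is
recovered as (1 - t)⁻¹(u - ty). -/
theorem lintegral_half_segment_le {p H : EuclideanSpace ℝ ι → ℝ≥0∞} (hp : Measurable p)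
    (hH : Measurable H) {A : ℝ≥0∞}
    (hK : ∀ u, ∫⁻ y, ∫⁻ t in Set.Ioc (0 : ℝ) (1 / 2),
      ‖u - y‖ₑ ^ 2 * p ((1 - t)⁻¹ • (u - t • y)) * p y ≤ A * p u) :
    ∫⁻ x, ∫⁻ y, ∫⁻ t in Set.Ioc (0 : ℝ) (1 / 2),
        p x * p y * (‖y - x‖ₑ ^ 2 * H (AffineMap.lineMap x y t)) ≤
      2 ^ (Fintype.card ι + 2) * A * ∫⁻ u, H u * p u := by
  set d := Fintype.card ι
  set Φ : EuclideanSpace ℝ ι → EuclideanSpace ℝ ι → ℝ → ℝ≥0∞ := fun x y t =>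
    p x * p y * (‖y - x‖ₑ ^ 2 * H (AffineMap.lineMap x y t)) with hΦ
  set Ψ : EuclideanSpace ℝ ι → EuclideanSpace ℝ ι → ℝ → ℝ≥0∞ := fun u y t =>
    ‖u - y‖ₑ ^ 2 * p ((1 - t)⁻¹ • (u - t • y)) * p y with hΨ
  have hmΦ : Measurable fun q : (EuclideanSpace ℝ ι × EuclideanSpace ℝ ι) × ℝ =>
      Φ q.1.1 q.1.2 q.2 := by
    have := hH.comp (measurable_lineMap_uncurry (ι := ι))
    simp only [hΦ]
    fun_prop
  have hmΨ : Measurable fun q : (EuclideanSpace ℝ ι × EuclideanSpace ℝ ι) × ℝ =>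
      Ψ q.1.1 q.1.2 q.2 := by
    simp only [hΨ]
    fun_prop
  have hin : ∀ y, ∀ t ∈ Set.Ioc (0 : ℝ) (1 / 2),
      ∫⁻ x, Φ x y t ≤ 2 ^ (d + 2) * ∫⁻ u, H u * Ψ u y t := by
    intro y t ht
    have ht0 : 0 < 1 - t := by linarith [ht.2]
    have ht1 : (1 - t)⁻¹ ≤ 2 := by
      rw [inv_le_comm₀ ht0 two_pos]
      linarith [ht.2]
    have hinv : ‖(1 - t)⁻¹‖ₑ ≤ 2 := by
      rw [← ofReal_norm, Real.norm_of_nonneg (inv_nonneg.2 ht0.le)]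
      exact ENNReal.ofReal_le_of_le_toReal (by simpa using ht1)
    set F : EuclideanSpace ℝ ι → ℝ≥0∞ := fun u =>
      p ((1 - t)⁻¹ • (u - t • y)) * p y * (‖(1 - t)⁻¹ • (y - u)‖ₑ ^ 2 * H u)
    have hF : Measurable F := by fun_prop
    have h1 : ∀ x, Φ x y t = F ((1 - t) • x + t • y) := by
      intro x
      have e1 : (1 - t)⁻¹ • ((1 - t) • x + t • y - t • y) = x := by
        rw [add_sub_cancel_right, inv_smul_smul₀ ht0.ne']
      have e2 : (1 - t)⁻¹ • (y - ((1 - t) • x + t • y)) = y - x := by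
        rw [show y - ((1 - t) • x + t • y) = (1 - t) • (y - x) by module,
          inv_smul_smul₀ ht0.ne']
      simp only [hΦ, F, e1, e2, AffineMap.lineMap_apply_module]
    simp only [h1]
    rw [lintegral_comp_smul_add F hF ht0, pow_add, mul_assoc]
    refine mul_le_mul' ?_ ?_
    · rw [← inv_pow, ENNReal.ofReal_pow (inv_nonneg.2 ht0.le)]
      exact pow_le_pow_left₀ zero_le (ENNReal.ofReal_le_of_le_toReal (by simpa using ht1)) _
    · rw [← lintegral_const_mul' _ _ (by simp)]
      refine lintegral_mono fun u => ?_
      simp only [F, hΨ]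
      rw [enorm_smul, mul_pow, ← enorm_neg (y - u), neg_sub]
      calc _ = ‖(1 - t)⁻¹‖ₑ ^ 2 * (H u * (‖u - y‖ₑ ^ 2 * p ((1 - t)⁻¹ • (u - t • y)) * p y)) := by
            ring
        _ ≤ _ := by gcongr
  calc ∫⁻ x, ∫⁻ y, ∫⁻ t in Set.Ioc (0 : ℝ) (1 / 2), Φ x y t
      = ∫⁻ y, ∫⁻ t in Set.Ioc (0 : ℝ) (1 / 2), ∫⁻ x, Φ x y t := by
        rw [lintegral_lintegral_swap (f := fun x y => ∫⁻ t in Set.Ioc (0 : ℝ) (1 / 2), Φ x y t)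
          (show Measurable (Function.uncurry fun x y => ∫⁻ t in Set.Ioc (0 : ℝ) (1 / 2), Φ x y t)
            from hmΦ.lintegral_prod_right').aemeasurable]
        refine lintegral_congr fun y => lintegral_lintegral_swap ?_
        exact (hmΦ.comp (f := fun q : EuclideanSpace ℝ ι × ℝ => ((q.1, y), q.2))
          (by fun_prop)).aemeasurable
    _ ≤ ∫⁻ y, ∫⁻ t in Set.Ioc (0 : ℝ) (1 / 2), 2 ^ (d + 2) * ∫⁻ u, H u * Ψ u y t :=
        lintegral_mono fun y => setLIntegral_mono' measurableSet_Ioc (hin y)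
    _ = 2 ^ (d + 2) * ∫⁻ y, ∫⁻ t in Set.Ioc (0 : ℝ) (1 / 2), ∫⁻ u, H u * Ψ u y t := by
        simp_rw [lintegral_const_mul' _ _ (ENNReal.pow_ne_top ENNReal.ofNat_ne_top :
          (2 : ℝ≥0∞) ^ (d + 2) ≠ ∞)]
    _ = 2 ^ (d + 2) * ∫⁻ u, H u * ∫⁻ y, ∫⁻ t in Set.Ioc (0 : ℝ) (1 / 2), Ψ u y t := by
        congr 1
        have hm2 : Measurable fun q : (EuclideanSpace ℝ ι × EuclideanSpace ℝ ι) × ℝ =>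
            H q.1.1 * Ψ q.1.1 q.1.2 q.2 := (hH.comp measurable_fst.fst).mul hmΨ
        have e1 : ∀ y, ∫⁻ t in Set.Ioc (0 : ℝ) (1 / 2), ∫⁻ u, H u * Ψ u y t =
            ∫⁻ u, ∫⁻ t in Set.Ioc (0 : ℝ) (1 / 2), H u * Ψ u y t := fun y =>
          lintegral_lintegral_swap (f := fun (t : ℝ) u => H u * Ψ u y t)
            (hm2.comp (f := fun q : ℝ × EuclideanSpace ℝ ι => ((q.2, y), q.1))
              (by fun_prop)).aemeasurable
        simp only [e1]
        rw [← lintegral_lintegral_swap (f := fun u y => ∫⁻ t in Set.Ioc (0 : ℝ) (1 / 2),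
          H u * Ψ u y t) (show Measurable (Function.uncurry fun u y =>
            ∫⁻ t in Set.Ioc (0 : ℝ) (1 / 2), H u * Ψ u y t)
              from hm2.lintegral_prod_right').aemeasurable]
        refine lintegral_congr fun u => ?_
        rw [← lintegral_const_mul _ (show Measurable fun y => ∫⁻ t in Set.Ioc (0 : ℝ) (1 / 2),
          Ψ u y t from hmΨ.lintegral_prod_right'.comp (f := fun y => (u, y)) (by fun_prop))]
        refine lintegral_congr fun y => ?_
        exact lintegral_const_mul _ (hmΨ.comp (f := fun t : ℝ => ((u, y), t)) (by fun_prop))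
    _ ≤ 2 ^ (d + 2) * ∫⁻ u, A * (H u * p u) := by
        refine mul_le_mul_right (lintegral_mono fun u => ?_) _
        rw [mul_left_comm]
        exact mul_le_mul_right (hK u) _
    _ = 2 ^ (d + 2) * A * ∫⁻ u, H u * p u := by
        rw [lintegral_const_mul _ (show Measurable fun u => H u * p u from hH.mul hp), mul_assoc]

theorem satisfiesPoincare_zero (S : Set (EuclideanSpace ℝ ι)) (c : ℝ≥0∞) :
    SatisfiesPoincare S 0 c := fun g _ _ _ => by simp

theorem SatisfiesPoincare.mono {S : Set (EuclideanSpace ℝ ι)} {μ : Measure (EuclideanSpace ℝ ι)}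
    {c c' : ℝ≥0∞} (h : SatisfiesPoincare S μ c) (hc : c ≤ c') : SatisfiesPoincare S μ c' :=
  fun g h1 h2 h3 => (h g h1 h2 h3).trans (mul_le_mul_left hc _)

/-- A Poincaré inequality for a density `p` on a convex set, under a bound on the contribution of
the segments that pass through a given point. -/
theorem satisfiesPoincare_of_segment_bound {S : Set (EuclideanSpace ℝ ι)} (hS : Convex ℝ S)
    {p : EuclideanSpace ℝ ι → ℝ≥0∞} (hp : Measurable p) (hpS : ∀ z, p z ≠ 0 ↔ z ∈ S)
    (hptop : ∀ z, p z ≠ ∞) {Q : ℝ≥0∞}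
    (hK : ∀ u, ∫⁻ y, ∫⁻ t in Set.Ioc (0 : ℝ) (1 / 2),
      ‖u - y‖ₑ ^ 2 * p ((1 - t)⁻¹ • (u - t • y)) * p y ≤ Q * (∫⁻ z, p z) * p u) :
    SatisfiesPoincare S (volume.withDensity fun z => p z / ∫⁻ z, p z)
      (2 ^ (Fintype.card ι + 3) * Q) := by
  set M := ∫⁻ z, p z with hM
  -- For M = 0 or M = ∞ the normalised density vanishes almost everywhere, so the inequality is
  -- trivial. Covering these cases lets the result apply to every slice.
  by_cases hM0 : M = 0
  · have : (volume.withDensity fun z => p z / M) = 0 := by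
      refine withDensity_eq_zero_iff (hp.div_const M).aemeasurable |>.2 ?_
      filter_upwards [(lintegral_eq_zero_iff hp).1 hM0] with z hz
      simp only [Pi.zero_apply] at hz ⊢
      simp [hz]
    rw [this]
    exact satisfiesPoincare_zero _ _
  by_cases hMtop : M = ∞
  · have : (volume.withDensity fun z => p z / M) = 0 := by
      simp only [hMtop, ENNReal.div_top]
      exact withDensity_zero
    rw [this]
    exact satisfiesPoincare_zero _ _
  intro g hg hg2 hgrad
  set q : EuclideanSpace ℝ ι → ℝ≥0∞ := fun z => p z / M with hq
  have hqm : Measurable q := hp.div_const M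
  have hqtop : ∀ z, q z < ∞ := fun z => ENNReal.div_lt_top (hptop z) hM0
  set μ := (volume : Measure (EuclideanSpace ℝ ι)).withDensity q with hμ
  have hprob : IsProbabilityMeasure μ := ⟨by
    rw [hμ, withDensity_apply _ MeasurableSet.univ, Measure.restrict_univ]
    simp only [hq, div_eq_mul_inv]
    rw [lintegral_mul_const _ hp, ← hM, ENNReal.mul_inv_cancel hM0 hMtop]⟩
  obtain ⟨G, hGm, hGeq⟩ : AEMeasurable (fun z => ‖∇ g z‖ₑ) μ := hgrad.1.aemeasurable.enorm
  -- The density is positive on `S`, so equality μ-almost everywhere becomes equality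
  -- Lebesgue-almost everywhere on `S`.
  have hGS : ∀ᵐ z, z ∈ S → DifferentiableAt ℝ g z ∧ ‖∇ g z‖ₑ ≤ G z := by
    filter_upwards [(ae_withDensity_iff hqm).1 hGeq, hg.differentiable] with z h1 h2 hz
    refine ⟨h2 hz, (h1 ?_).le⟩
    exact (ENNReal.div_pos ((hpS z).2 hz) hMtop).ne'
  have hpair : ∀ᵐ x, ∀ᵐ y, p x * p y * ‖g y - g x‖ₑ ^ 2 ≤ ∫⁻ t in Set.Ioc (0 : ℝ) 1,
      p x * p y * (‖y - x‖ₑ ^ 2 * G (AffineMap.lineMap x y t) ^ 2) := by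
    filter_upwards [ae_ae_lineMap hGS] with x hx
    filter_upwards [hx] with y hy
    by_cases hxS : x ∈ S
    swap
    · have : p x = 0 := by by_contra h; exact hxS ((hpS x).1 h)
      simp [this]
    by_cases hyS : y ∈ S
    swap
    · have : p y = 0 := by by_contra h; exact hyS ((hpS y).1 h)
      simp [this]
    have hseg : segment ℝ x y ⊆ S := hS.segment_subset hxS hyS
    have h1 := hg.enorm_sub_le hseg (G := G) (by
      filter_upwards [hy, ae_restrict_mem measurableSet_Ioc] with t ht ht'
      refine ht (hseg ?_)
      rw [segment_eq_image_lineMap]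
      exact ⟨t, ⟨ht'.1.le, ht'.2⟩, rfl⟩)
    have hGl : Measurable fun t : ℝ => G (AffineMap.lineMap x y t) :=
      hGm.comp AffineMap.lineMap_continuous.measurable
    -- The parameter interval has length one, so the square of the integral of `G` is at most the
    -- integral of its square.
    have : IsProbabilityMeasure ((volume : Measure ℝ).restrict (Set.Ioc 0 1)) := ⟨by simp⟩
    have e1 : ∫⁻ t in Set.Ioc (0 : ℝ) 1,
        p x * p y * (‖y - x‖ₑ ^ 2 * G (AffineMap.lineMap x y t) ^ 2) =
        p x * p y * (‖y - x‖ₑ ^ 2 * ∫⁻ t in Set.Ioc (0 : ℝ) 1,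
          G (AffineMap.lineMap x y t) ^ 2) := by
      rw [lintegral_const_mul' _ _ (ENNReal.mul_ne_top (hptop x) (hptop y)),
        lintegral_const_mul' _ _ (ENNReal.pow_ne_top enorm_ne_top)]
    rw [e1]
    have h2 := pow_le_pow_left₀ zero_le h1 2
    rw [mul_pow] at h2
    exact mul_le_mul_right (h2.trans (mul_le_mul_right
      (sq_lintegral_le_lintegral_sq hGl.aemeasurable) _)) _
  have hH : Measurable fun z => G z ^ 2 := hGm.pow_const 2
  have hD := (lintegral_segment_le_two_mul hp hH).trans
    (mul_le_mul_right (lintegral_half_segment_le hp hH hK) 2)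
  have hconv : ∀ F : EuclideanSpace ℝ ι → ℝ≥0∞, ∫⁻ z, F z ∂μ = M⁻¹ * ∫⁻ z, p z * F z := by
    intro F
    rw [hμ, lintegral_withDensity_eq_lintegral_mul_non_measurable _ hqm (ae_of_all _ hqtop),
      ← lintegral_const_mul' _ _ (ENNReal.inv_ne_top.2 hM0)]
    refine lintegral_congr fun z => ?_
    simp only [Pi.mul_apply, hq, div_eq_mul_inv]
    ring
  calc evariance g μ ≤ ∫⁻ x, ∫⁻ y, ‖g y - g x‖ₑ ^ 2 ∂μ ∂μ := evariance_le_lintegral_lintegral hg2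
    _ = M⁻¹ * ∫⁻ x, M⁻¹ * ∫⁻ y, p x * p y * ‖g y - g x‖ₑ ^ 2 := by
        rw [hconv]
        congr 1
        refine lintegral_congr fun x => ?_
        rw [hconv, mul_left_comm, ← lintegral_const_mul' _ _ (hptop x)]
        simp only [mul_assoc]
    _ ≤ M⁻¹ * ∫⁻ x, M⁻¹ * ∫⁻ y, ∫⁻ t in Set.Ioc (0 : ℝ) 1,
        p x * p y * (‖y - x‖ₑ ^ 2 * G (AffineMap.lineMap x y t) ^ 2) := by
        refine mul_le_mul_right (lintegral_mono_ae ?_) _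
        filter_upwards [hpair] with x hx
        exact mul_le_mul_right (lintegral_mono_ae hx) _
    _ = M⁻¹ * (M⁻¹ * ∫⁻ x, ∫⁻ y, ∫⁻ t in Set.Ioc (0 : ℝ) 1,
        p x * p y * (‖y - x‖ₑ ^ 2 * G (AffineMap.lineMap x y t) ^ 2)) := by
        congr 1
        exact lintegral_const_mul' _ _ (ENNReal.inv_ne_top.2 hM0)
    _ ≤ M⁻¹ * (M⁻¹ * (2 * (2 ^ (Fintype.card ι + 2) * (Q * M) * ∫⁻ u, G u ^ 2 * p u))) := by
        exact mul_le_mul_right (mul_le_mul_right hD _) _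
    _ = 2 ^ (Fintype.card ι + 3) * Q * (M⁻¹ * M) * (M⁻¹ * ∫⁻ u, p u * G u ^ 2) := by
        simp only [mul_comm (p _)]
        ring
    _ = 2 ^ (Fintype.card ι + 3) * Q * ∫⁻ z, ‖∇ g z‖ₑ ^ 2 ∂μ := by
        rw [ENNReal.inv_mul_cancel hM0 hMtop, mul_one, ← hconv]
        congr 1
        refine lintegral_congr_ae ?_
        filter_upwards [hGeq] with z hz
        rw [hz]

end Segments

/-! ### Poincaré inequalities for two classes of densities -/

section Densities

variable {ι : Type*} [Fintype ι]

/-- In the segment bound, |u - y| is at most the diameter `D` and the density at the starting point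
is at most `R` times that at u. What remains is the mass of `p`. -/
theorem satisfiesPoincare_of_bounded_convex {S : Set (EuclideanSpace ℝ ι)} (hS : Convex ℝ S)
    {p : EuclideanSpace ℝ ι → ℝ≥0∞} (hp : Measurable p) (hpS : ∀ z, p z ≠ 0 ↔ z ∈ S)
    (hptop : ∀ z, p z ≠ ∞) {D R : ℝ≥0∞} (hD : ∀ u ∈ S, ∀ v ∈ S, ‖u - v‖ₑ ≤ D)
    (hR : ∀ u ∈ S, ∀ v ∈ S, p u ≤ R * p v) :
    SatisfiesPoincare S (volume.withDensity fun z => p z / ∫⁻ z, p z)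
      (2 ^ (Fintype.card ι + 3) * (D ^ 2 * R)) := by
  refine satisfiesPoincare_of_segment_bound hS hp hpS hptop fun u => ?_
  have h : ∀ y, ∫⁻ t in Set.Ioc (0 : ℝ) (1 / 2),
      ‖u - y‖ₑ ^ 2 * p ((1 - t)⁻¹ • (u - t • y)) * p y ≤ D ^ 2 * (R * p u) * p y := by
    intro y
    calc ∫⁻ t in Set.Ioc (0 : ℝ) (1 / 2), ‖u - y‖ₑ ^ 2 * p ((1 - t)⁻¹ • (u - t • y)) * p y
        ≤ ∫⁻ t in Set.Ioc (0 : ℝ) (1 / 2), D ^ 2 * (R * p u) * p y := by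
          refine setLIntegral_mono' measurableSet_Ioc fun t ht => ?_
          by_cases hy : p y = 0
          · simp [hy]
          by_cases hx : p ((1 - t)⁻¹ • (u - t • y)) = 0
          · simp [hx]
          have hyS := (hpS _).1 hy
          have hxS := (hpS _).1 hx
          have ht0 : 0 < 1 - t := by linarith [ht.2]
          -- The point u is the convex combination, with weights 1 - t and t, of the starting point
          -- and y.
          have hu : u ∈ S := by
            have := hS hxS hyS ht0.le ht.1.le (by ring)
            rwa [smul_inv_smul₀ ht0.ne', sub_add_cancel] at this
          gcongr
          · exact hD u hu y hyS
          · exact hR _ hxS u hu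
      _ = D ^ 2 * (R * p u) * p y * ENNReal.ofReal (1 / 2) := by simp
      _ ≤ D ^ 2 * (R * p u) * p y := mul_le_of_le_one_right' (by
          refine ENNReal.ofReal_le_one.2 (by norm_num))
  calc _ ≤ ∫⁻ y, D ^ 2 * (R * p u) * p y := lintegral_mono h
    _ = _ := by rw [lintegral_const_mul _ hp]; ring

/-- This compares Gaussian exponents at the ends of a segment with the one at its point u. The gain
t‖u‖²/2 will pay for a factor ‖u‖² after integration in t, and the remainder ‖y‖²/10 gives
integrability in y. -/
theorem segment_start_norm_bound {E : Type*} [NormedAddCommGroup E] [InnerProductSpace ℝ E]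
    (u y : E) {t : ℝ} (ht : 0 < t) (ht' : t ≤ 1 / 2) :
    (1 + t / 2) * ‖u‖ ^ 2 + ‖y‖ ^ 2 / 10 ≤ ‖(1 - t)⁻¹ • (u - t • y)‖ ^ 2 + ‖y‖ ^ 2 := by
  have ht0 : 0 < 1 - t := by linarith
  rw [norm_smul, mul_pow, Real.norm_of_nonneg (inv_nonneg.2 ht0.le), norm_sub_sq_real, norm_smul,
    inner_smul_right, Real.norm_of_nonneg ht.le]
  -- Weighted Young inequality, with the weights chosen to leave positive multiples of both t‖u‖²
  -- and ‖y‖².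
  have h1 : 2 * inner ℝ u y ≤ 5 / 4 * ‖u‖ ^ 2 + 4 / 5 * ‖y‖ ^ 2 := by
    nlinarith [real_inner_le_norm u y, sq_nonneg (5 * ‖u‖ - 4 * ‖y‖)]
  have h2 : (1 - t)⁻¹ ^ 2 * (1 - t) ^ 2 = 1 := by
    rw [← mul_pow, inv_mul_cancel₀ ht0.ne', one_pow]
  set a := ‖u‖ ^ 2
  set b := ‖y‖ ^ 2
  have ha : 0 ≤ a := by positivity
  have hb : 0 ≤ b := by positivity
  have h3 : (1 - t) ^ 2 * ((1 + t / 2) * a - 9 / 10 * b) ≤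
      a - 2 * (t * inner ℝ u y) + (t * ‖y‖) ^ 2 := by
    rw [mul_pow]
    have e1 : 0 ≤ t * (1 / 4 - t ^ 2 / 2) * a := by
      have : 0 ≤ 1 / 4 - t ^ 2 / 2 := by nlinarith
      positivity
    have e2 : 0 ≤ (9 / 10 - 26 / 10 * t + 19 / 10 * t ^ 2) * b :=
      mul_nonneg (by nlinarith) hb
    have e3 := mul_le_mul_of_nonneg_left h1 ht.le
    nlinarith
  have h4 := mul_le_mul_of_nonneg_left h3 (sq_nonneg (1 - t)⁻¹)
  rw [← mul_assoc, h2, one_mul] at h4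
  linarith

/-- The point is uniformity in s: the exponential gain in t absorbs the unbounded factor s = ‖u‖².
-/
theorem lintegral_sq_mul_exp_le {κ : ℝ} (hκ : 0 < κ) (s : ℝ) (hs : 0 ≤ s) :
    ∫⁻ t in Set.Ioc (0 : ℝ) (1 / 2), ENNReal.ofReal (s * Real.exp (-κ * (t / 2 * s))) ≤
      ENNReal.ofReal (2 / κ) := by
  have hc : Continuous fun t : ℝ => s * Real.exp (-κ * (t / 2 * s)) := by fun_prop
  rw [← ofReal_integral_eq_lintegral_ofReal
    (hc.integrableOn_Ioc) (ae_of_all _ fun t => by positivity),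
    ← intervalIntegral.integral_of_le (by norm_num)]
  refine ENNReal.ofReal_le_ofReal ?_
  have hd : ∀ t : ℝ, HasDerivAt (fun t : ℝ => -(2 / κ) * Real.exp (-κ * (t / 2 * s)))
      (s * Real.exp (-κ * (t / 2 * s))) t := by
    intro t
    have h1 : HasDerivAt (fun t : ℝ => -κ * (t / 2 * s)) (-κ * (1 / 2 * s)) t :=
      (((hasDerivAt_id t).div_const 2).mul_const s).const_mul (-κ)
    refine (h1.exp.const_mul (-(2 / κ))).congr_deriv ?_
    field_simp
  rw [intervalIntegral.integral_eq_sub_of_hasDerivAt (fun t _ => hd t)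
    (hc.intervalIntegrable _ _)]
  have : 0 ≤ 2 / κ * Real.exp (-κ * (1 / 2 / 2 * s)) := by positivity
  simp only [zero_div, zero_mul, mul_zero, Real.exp_zero]
  linarith

theorem lintegral_gaussian_ne_top {b : ℝ} (hb : 0 < b) :
    ∫⁻ z : EuclideanSpace ℝ ι, ENNReal.ofReal (Real.exp (-b * ‖z‖ ^ 2)) ≠ ∞ := by
  have h : Integrable fun z : EuclideanSpace ℝ ι => Real.exp (-b * ‖z‖ ^ 2) := by
    -- The integral of a non-integrable function is 0 by convention, so a nonzero value proves
    -- integrability.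
    refine not_imp_comm.1 integral_undef ?_
    rw [GaussianFourier.integral_rexp_neg_mul_sq_norm hb]
    positivity
  rw [← ofReal_integral_eq_lintegral_ofReal h (ae_of_all _ fun z => by positivity)]
  exact ENNReal.ofReal_ne_top

theorem lintegral_gaussian_ne_zero (b : ℝ) :
    ∫⁻ z : EuclideanSpace ℝ ι, ENNReal.ofReal (Real.exp (-b * ‖z‖ ^ 2)) ≠ 0 := by
  rw [Ne, lintegral_eq_zero_iff (by fun_prop)]
  intro h
  have : ∀ᵐ z : EuclideanSpace ℝ ι, False := by
    filter_upwards [h] with z hz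
    simp only [Pi.zero_apply, ENNReal.ofReal_eq_zero] at hz
    exact absurd hz (not_le.2 (Real.exp_pos _))
  exact NeZero.ne _ (by simpa using this)

/-- From |u - y|² ≤ 2‖u‖² + 2‖y‖², the first term is absorbed by the integration in t, the second by
half of the decay exp(-κ‖y‖²/10). The other half is the κ/20 in the conclusion. -/
theorem gaussian_segment_bound {κ : ℝ} (hκ : 0 < κ) (u y : EuclideanSpace ℝ ι) :
    ∫⁻ t in Set.Ioc (0 : ℝ) (1 / 2), ENNReal.ofReal (‖u - y‖ ^ 2 *
        (Real.exp (-κ * ‖(1 - t)⁻¹ • (u - t • y)‖ ^ 2) * Real.exp (-κ * ‖y‖ ^ 2))) ≤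
      ENNReal.ofReal (44 / κ * Real.exp (-κ * ‖u‖ ^ 2)) *
        ENNReal.ofReal (Real.exp (-(κ / 20) * ‖y‖ ^ 2)) := by
  set a := ‖u‖ ^ 2
  set b := ‖y‖ ^ 2
  have ha : 0 ≤ a := by positivity
  have hb : 0 ≤ b := by positivity
  have hsq : ‖u - y‖ ^ 2 ≤ 2 * a + 2 * b := by
    have := norm_sub_le u y
    nlinarith [sq_nonneg (‖u‖ - ‖y‖), norm_nonneg (u - y), norm_nonneg u, norm_nonneg y]
  have hpt : ∀ t ∈ Set.Ioc (0 : ℝ) (1 / 2), ENNReal.ofReal (‖u - y‖ ^ 2 *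
      (Real.exp (-κ * ‖(1 - t)⁻¹ • (u - t • y)‖ ^ 2) * Real.exp (-κ * ‖y‖ ^ 2))) ≤
      ENNReal.ofReal (Real.exp (-κ * a) * Real.exp (-(κ / 10) * b)) *
        (ENNReal.ofReal 2 * ENNReal.ofReal (a * Real.exp (-κ * (t / 2 * a))) + ENNReal.ofReal (2 * b)) := by
    intro t ht
    rw [← ENNReal.ofReal_mul (by norm_num), ← ENNReal.ofReal_add (by positivity)
      (by positivity), ← ENNReal.ofReal_mul (by positivity)]
    refine ENNReal.ofReal_le_ofReal ?_
    have h1 := segment_start_norm_bound u y ht.1 ht.2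
    calc _ ≤ (2 * a + 2 * b) * (Real.exp (-κ * a) * Real.exp (-(κ / 10) * b) *
          Real.exp (-κ * (t / 2 * a))) := by
          refine mul_le_mul hsq ?_ (by positivity) (by positivity)
          rw [← Real.exp_add, ← Real.exp_add, ← Real.exp_add]
          refine Real.exp_le_exp.2 ?_
          nlinarith [mul_le_mul_of_nonneg_left h1 hκ.le]
      _ ≤ _ := by
          -- The decay in t is kept only on the term with `a`, where it is needed; on the term with
          -- `b` it is bounded by 1.
          have h2 : Real.exp (-κ * (t / 2 * a)) ≤ 1 := by
            refine Real.exp_le_one_iff.2 ?_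
            have : 0 ≤ κ * (t / 2 * a) := by have := ht.1; positivity
            linarith
          have h3 : 0 ≤ Real.exp (-κ * a) * Real.exp (-(κ / 10) * b) := by positivity
          have h4 := mul_le_mul_of_nonneg_left h2 (show 0 ≤ 2 * b by positivity)
          nlinarith [mul_le_mul_of_nonneg_left h4 h3]
  calc _ ≤ _ := setLIntegral_mono' measurableSet_Ioc hpt
    _ = ENNReal.ofReal (Real.exp (-κ * a) * Real.exp (-(κ / 10) * b)) *
        (ENNReal.ofReal 2 * (∫⁻ t in Set.Ioc (0 : ℝ) (1 / 2), ENNReal.ofReal (a * Real.exp (-κ * (t / 2 * a)))) +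
          ENNReal.ofReal (2 * b) * ENNReal.ofReal (1 / 2)) := by
        rw [lintegral_const_mul' _ _ ENNReal.ofReal_ne_top, lintegral_add_right _ measurable_const,
          lintegral_const_mul' _ _ ENNReal.ofReal_ne_top]
        simp
    _ ≤ ENNReal.ofReal (Real.exp (-κ * a) * Real.exp (-(κ / 10) * b)) *
        (ENNReal.ofReal 2 * ENNReal.ofReal (2 / κ) +
          ENNReal.ofReal (2 * b) * ENNReal.ofReal (1 / 2)) := by
        have := lintegral_sq_mul_exp_le hκ a ha
        gcongr
    _ ≤ _ := by
        rw [← ENNReal.ofReal_mul (by norm_num), ← ENNReal.ofReal_mul (by positivity),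
          ← ENNReal.ofReal_add (by positivity) (by positivity), ← ENNReal.ofReal_mul
          (by positivity), ← ENNReal.ofReal_mul (by positivity)]
        refine ENNReal.ofReal_le_ofReal ?_
        -- By 1 + s ≤ exp s, any constant from 20 upwards would do in place of 44.
        have h1 : 2 * (2 / κ) + 2 * b * (1 / 2) ≤ 44 / κ * Real.exp (κ / 20 * b) := by
          have h2 := Real.add_one_le_exp (κ / 20 * b)
          have h3 : 44 / κ * (κ / 20 * b + 1) ≤ 44 / κ * Real.exp (κ / 20 * b) := by gcongr
          have h4 : 44 / κ * (κ / 20 * b + 1) = 44 / 20 * b + 44 / κ := by field_simp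
          have h5 : 0 ≤ 1 / κ := by positivity
          have h6 : 2 * (2 / κ) = 4 * (1 / κ) := by ring
          have h7 : 44 / κ = 44 * (1 / κ) := by ring
          linarith
        have h8 : Real.exp (-(κ / 20) * b) = Real.exp (-(κ / 10) * b) * Real.exp (κ / 20 * b) := by
          rw [← Real.exp_add]; ring_nf
        rw [h8]
        have h9 : 0 ≤ Real.exp (-κ * a) * Real.exp (-(κ / 10) * b) := by positivity
        nlinarith [mul_le_mul_of_nonneg_left h1 h9]

/-- The scale `α` drops out, because the segment integral and the product of total mass and p(u) are
both quadratic in it. Hence the constant is uniform over slices, which differ in scale by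
exp(-κ‖y‖²). -/
theorem satisfiesPoincare_of_gaussian_bounds {p : EuclideanSpace ℝ ι → ℝ≥0∞} (hp : Measurable p)
    {κ α r : ℝ} (hκ : 0 < κ) (hα : 0 < α) (hr : 0 < r)
    (hlow : ∀ z, ENNReal.ofReal (α * Real.exp (-κ * ‖z‖ ^ 2)) ≤ p z)
    (hup : ∀ z, p z ≤ ENNReal.ofReal (r * α * Real.exp (-κ * ‖z‖ ^ 2))) :
    SatisfiesPoincare Set.univ (volume.withDensity fun z => p z / ∫⁻ z, p z)
      (2 ^ (Fintype.card ι + 3) * (ENNReal.ofReal (r ^ 2 * (44 / κ)) *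
        ((∫⁻ z : EuclideanSpace ℝ ι, ENNReal.ofReal (Real.exp (-(κ / 20) * ‖z‖ ^ 2))) /
          ∫⁻ z : EuclideanSpace ℝ ι, ENNReal.ofReal (Real.exp (-κ * ‖z‖ ^ 2))))) := by
  set Z₀ := ∫⁻ z : EuclideanSpace ℝ ι, ENNReal.ofReal (Real.exp (-(κ / 20) * ‖z‖ ^ 2)) with hZ₀
  set Z₁ := ∫⁻ z : EuclideanSpace ℝ ι, ENNReal.ofReal (Real.exp (-κ * ‖z‖ ^ 2)) with hZ₁
  have hZ₁0 : Z₁ ≠ 0 := lintegral_gaussian_ne_zero κ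
  have hZ₁top : Z₁ ≠ ∞ := lintegral_gaussian_ne_top hκ
  have hpos : ∀ z, p z ≠ 0 := fun z =>
    ((ENNReal.ofReal_pos.2 (by positivity)).trans_le (hlow z)).ne'
  have htop : ∀ z, p z ≠ ∞ := fun z => ((hup z).trans_lt ENNReal.ofReal_lt_top).ne
  refine satisfiesPoincare_of_segment_bound convex_univ hp (by simpa using hpos) htop fun u => ?_
  have hM : ENNReal.ofReal α * Z₁ ≤ ∫⁻ z, p z := by
    rw [hZ₁, ← lintegral_const_mul' _ _ ENNReal.ofReal_ne_top]
    refine lintegral_mono fun z => ?_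
    rw [← ENNReal.ofReal_mul hα.le]
    exact hlow z
  have h1 : ∀ y, ∫⁻ t in Set.Ioc (0 : ℝ) (1 / 2),
      ‖u - y‖ₑ ^ 2 * p ((1 - t)⁻¹ • (u - t • y)) * p y ≤
      ENNReal.ofReal ((r * α) ^ 2) * ENNReal.ofReal (44 / κ * Real.exp (-κ * ‖u‖ ^ 2)) *
        ENNReal.ofReal (Real.exp (-(κ / 20) * ‖y‖ ^ 2)) := by
    intro y
    rw [mul_assoc]
    refine le_trans ?_ (mul_le_mul_right (gaussian_segment_bound hκ u y) _)
    rw [← lintegral_const_mul' _ _ ENNReal.ofReal_ne_top]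
    refine lintegral_mono fun t => ?_
    dsimp only
    rw [← ENNReal.ofReal_mul (by positivity), ← ofReal_norm, ← ENNReal.ofReal_pow (norm_nonneg _)]
    calc _ ≤ ENNReal.ofReal (‖u - y‖ ^ 2) *
          ENNReal.ofReal (r * α * Real.exp (-κ * ‖(1 - t)⁻¹ • (u - t • y)‖ ^ 2)) *
          ENNReal.ofReal (r * α * Real.exp (-κ * ‖y‖ ^ 2)) := by
          gcongr
          · exact hup _
          · exact hup _
      _ = _ := by
          rw [← ENNReal.ofReal_mul (by positivity), ← ENNReal.ofReal_mul (by positivity)]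
          congr 1
          ring
  calc _ ≤ ∫⁻ y, ENNReal.ofReal ((r * α) ^ 2) *
        ENNReal.ofReal (44 / κ * Real.exp (-κ * ‖u‖ ^ 2)) *
        ENNReal.ofReal (Real.exp (-(κ / 20) * ‖y‖ ^ 2)) := lintegral_mono h1
    _ = ENNReal.ofReal ((r * α) ^ 2) *
        ENNReal.ofReal (44 / κ * Real.exp (-κ * ‖u‖ ^ 2)) * Z₀ := by
        rw [lintegral_const_mul _ (by fun_prop)]
    _ = ENNReal.ofReal (r ^ 2 * (44 / κ)) * (Z₀ / Z₁) * (ENNReal.ofReal α * Z₁) *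
        ENNReal.ofReal (α * Real.exp (-κ * ‖u‖ ^ 2)) := by
        have e1 : Z₀ = Z₀ / Z₁ * Z₁ := (ENNReal.div_mul_cancel hZ₁0 hZ₁top).symm
        have e2 : ENNReal.ofReal ((r * α) ^ 2) *
            ENNReal.ofReal (44 / κ * Real.exp (-κ * ‖u‖ ^ 2)) =
            ENNReal.ofReal (r ^ 2 * (44 / κ)) * ENNReal.ofReal α *
              ENNReal.ofReal (α * Real.exp (-κ * ‖u‖ ^ 2)) := by
          rw [← ENNReal.ofReal_mul (by positivity), ← ENNReal.ofReal_mul (by positivity),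
            ← ENNReal.ofReal_mul (by positivity)]
          congr 1
          ring
        rw [e2]
        nth_rewrite 1 [e1]
        ring
    _ ≤ _ := by
        gcongr
        exact hlow u

end Densities

/-! ### Rotated coordinates -/

section Coordinates

variable {m : ℕ} {W : Matrix (Fin m) (Fin m) ℝ} {n : ℕ}

theorem sum_active_add_sum_inactive {M : Type*} [AddCommMonoid M] (n : ℕ) (F : Fin m → M) :
    ∑ i : ActiveIdx m n, F i + ∑ i : InactiveIdx m n, F i = ∑ i, F i := by
  rw [← Fintype.sum_subtype_add_sum_subtype (fun i : Fin m => i.val < n) F]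
  congr 1
  exact Fintype.sum_equiv (Equiv.subtypeEquivRight (by simp)) _ _ fun _ => rfl

/-- The vector with first coordinates `y` and last coordinates `z`. -/
def joinCoords (m n : ℕ) (y : ActiveIdx m n → ℝ) (z : InactiveIdx m n → ℝ) (i : Fin m) : ℝ :=
  if h : i.val < n then y ⟨i, h⟩ else z ⟨i, not_lt.1 h⟩

@[simp] theorem joinCoords_active (y : ActiveIdx m n → ℝ) (z : InactiveIdx m n → ℝ)
    (i : ActiveIdx m n) : joinCoords m n y z i = y i := dif_pos i.2

@[simp] theorem joinCoords_inactive (y : ActiveIdx m n → ℝ) (z : InactiveIdx m n → ℝ)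
    (i : InactiveIdx m n) : joinCoords m n y z i = z i := dif_neg (not_lt.2 i.2)

theorem fromCoords_eq_mulVec (W : Matrix (Fin m) (Fin m) ℝ) (n : ℕ)
    (y : EuclideanSpace ℝ (ActiveIdx m n)) (z : EuclideanSpace ℝ (InactiveIdx m n)) :
    fromCoords W n y z = WithLp.toLp 2 (W.mulVec (joinCoords m n y.ofLp z.ofLp)) := by
  ext i
  simp [fromCoords, firstCols, lastCols, Matrix.mulVec, dotProduct,
    ← sum_active_add_sum_inactive n fun j => W i j * joinCoords m n y.ofLp z.ofLp j]

theorem norm_mulVec_sq (hW : W ∈ Matrix.orthogonalGroup (Fin m) ℝ) (v : Fin m → ℝ) :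
    ‖(WithLp.toLp 2 (W.mulVec v) : EuclideanSpace ℝ (Fin m))‖ ^ 2 = ∑ i, v i ^ 2 := by
  have h : W.transpose * W = 1 := (Matrix.mem_orthogonalGroup_iff' _ _).1 hW
  have h2 : W.mulVec v ⬝ᵥ W.mulVec v = v ⬝ᵥ v := by
    rw [Matrix.dotProduct_mulVec, Matrix.vecMul_mulVec, h, Matrix.vecMul_one]
  rw [EuclideanSpace.real_norm_sq_eq]
  simpa [dotProduct, sq] using h2

theorem norm_fromCoords_sq (hW : W ∈ Matrix.orthogonalGroup (Fin m) ℝ)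
    (y : EuclideanSpace ℝ (ActiveIdx m n)) (z : EuclideanSpace ℝ (InactiveIdx m n)) :
    ‖fromCoords W n y z‖ ^ 2 = ‖y‖ ^ 2 + ‖z‖ ^ 2 := by
  rw [fromCoords_eq_mulVec, norm_mulVec_sq hW, EuclideanSpace.real_norm_sq_eq,
    EuclideanSpace.real_norm_sq_eq,
    ← sum_active_add_sum_inactive n fun i => joinCoords m n y.ofLp z.ofLp i ^ 2]
  simp

theorem activeCoord_fromCoords (hW : W ∈ Matrix.orthogonalGroup (Fin m) ℝ)
    (y : EuclideanSpace ℝ (ActiveIdx m n)) (z : EuclideanSpace ℝ (InactiveIdx m n)) :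
    activeCoord W n (fromCoords W n y z) = y := by
  have h : W.transpose * W = 1 := (Matrix.mem_orthogonalGroup_iff' _ _).1 hW
  ext i
  have h1 : ∀ v, ((firstCols W n).transpose.mulVec v) i = (W.transpose.mulVec v) i := fun v => rfl
  rw [fromCoords_eq_mulVec]
  simp only [activeCoord]
  rw [h1, Matrix.mulVec_mulVec, h, Matrix.one_mulVec, joinCoords_active]

/-- The isometry `(y, z) ↦ W₁ y + W₂ z`. -/
def coordsLinearMap (W : Matrix (Fin m) (Fin m) ℝ) (n : ℕ) :
    WithLp 2 (EuclideanSpace ℝ (ActiveIdx m n) × EuclideanSpace ℝ (InactiveIdx m n)) →ₗ[ℝ]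
      EuclideanSpace ℝ (Fin m) where
  toFun q := fromCoords W n q.fst q.snd
  map_add' q r := by
    ext i
    simp [fromCoords, Matrix.mulVec_add]
    ring
  map_smul' c q := by
    ext i
    simp [fromCoords, Matrix.mulVec_smul]

/-- The isometry `(y, z) ↦ W₁ y + W₂ z`, as an equivalence. -/
def coordsEquiv (hW : W ∈ Matrix.orthogonalGroup (Fin m) ℝ) (n : ℕ) :
    WithLp 2 (EuclideanSpace ℝ (ActiveIdx m n) × EuclideanSpace ℝ (InactiveIdx m n)) ≃ₗᵢ[ℝ]
      EuclideanSpace ℝ (Fin m) :=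
  LinearIsometry.toLinearIsometryEquiv
    { coordsLinearMap W n with
      norm_map' := fun q => by
        rw [← sq_eq_sq₀ (norm_nonneg _) (norm_nonneg _), WithLp.prod_norm_sq_eq_of_L2]
        exact norm_fromCoords_sq hW _ _ }
    (by
      rw [(WithLp.linearEquiv 2 ℝ (EuclideanSpace ℝ (ActiveIdx m n) ×
          EuclideanSpace ℝ (InactiveIdx m n))).finrank_eq, Module.finrank_prod]
      simp only [finrank_euclideanSpace]
      have h := sum_active_add_sum_inactive n fun _ : Fin m => 1
      simpa using h)

theorem measurePreserving_fromCoords (hW : W ∈ Matrix.orthogonalGroup (Fin m) ℝ) (n : ℕ) :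
    MeasurePreserving (fun q : EuclideanSpace ℝ (ActiveIdx m n) × EuclideanSpace ℝ (InactiveIdx m n)
      => fromCoords W n q.1 q.2) :=
  (coordsEquiv hW n).measurePreserving.comp (WithLp.volume_preserving_toLp _ _)

theorem continuous_fromCoords (W : Matrix (Fin m) (Fin m) ℝ) (n : ℕ) :
    Continuous (fun q : EuclideanSpace ℝ (ActiveIdx m n) × EuclideanSpace ℝ (InactiveIdx m n)
      => fromCoords W n q.1 q.2) := by
  unfold fromCoords
  fun_prop

theorem continuous_activeCoord (W : Matrix (Fin m) (Fin m) ℝ) (n : ℕ) :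
    Continuous (activeCoord W n) := by
  unfold activeCoord
  fun_prop

/-- The linear map `z ↦ W₂ z`. -/
def lastColsMap (W : Matrix (Fin m) (Fin m) ℝ) (n : ℕ) :
    EuclideanSpace ℝ (InactiveIdx m n) →L[ℝ] EuclideanSpace ℝ (Fin m) :=
  LinearMap.toContinuousLinearMap
    { toFun := fun z => WithLp.toLp 2 ((lastCols W n).mulVec z.ofLp)
      map_add' := fun z z' => by ext i; simp [Matrix.mulVec_add]
      map_smul' := fun c z => by ext i; simp [Matrix.mulVec_smul] }

theorem fromCoords_eq_add (W : Matrix (Fin m) (Fin m) ℝ) (n : ℕ)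
    (y : EuclideanSpace ℝ (ActiveIdx m n)) (z : EuclideanSpace ℝ (InactiveIdx m n)) :
    fromCoords W n y z = lastColsMap W n z + fromCoords W n y 0 := by
  ext i
  simp [fromCoords, lastColsMap, add_comm]

theorem norm_lastColsMap (hW : W ∈ Matrix.orthogonalGroup (Fin m) ℝ)
    (z : EuclideanSpace ℝ (InactiveIdx m n)) : ‖lastColsMap W n z‖ = ‖z‖ := by
  have h : lastColsMap W n z = fromCoords W n 0 z := by
    ext i
    simp [fromCoords, lastColsMap]
  rw [← sq_eq_sq₀ (norm_nonneg _) (norm_nonneg _), h, norm_fromCoords_sq hW]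
  simp

theorem fromCoords_lineMap (W : Matrix (Fin m) (Fin m) ℝ) (n : ℕ)
    (y : EuclideanSpace ℝ (ActiveIdx m n)) (z z' : EuclideanSpace ℝ (InactiveIdx m n)) (t : ℝ) :
    fromCoords W n y (AffineMap.lineMap z z' t) =
      AffineMap.lineMap (fromCoords W n y z) (fromCoords W n y z') t := by
  rw [fromCoords_eq_add W n y (AffineMap.lineMap z z' t), fromCoords_eq_add W n y z,
    fromCoords_eq_add W n y z']
  simp only [AffineMap.lineMap_apply_module, map_add, map_smul]
  module

end Coordinates

/-! ### Finiteness of the Poincaré constant -/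

section Finiteness

variable {m : ℕ} {X : Set (EuclideanSpace ℝ (Fin m))} {ρ : EuclideanSpace ℝ (Fin m) → ℝ}

theorem measurable_jointDensity_uncurry (hρ : Measurable ρ) (W : Matrix (Fin m) (Fin m) ℝ) (n : ℕ) :
    Measurable fun q : EuclideanSpace ℝ (ActiveIdx m n) × EuclideanSpace ℝ (InactiveIdx m n) =>
      jointDensity W n ρ q.1 q.2 :=
  (hρ.comp (continuous_fromCoords W n).measurable).ennreal_ofReal

theorem measurable_jointDensity (hρ : Measurable ρ) (W : Matrix (Fin m) (Fin m) ℝ) (n : ℕ)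
    (y : EuclideanSpace ℝ (ActiveIdx m n)) : Measurable (jointDensity W n ρ y) :=
  (hρ.comp ((continuous_fromCoords W n).comp
    (Continuous.prodMk_right y)).measurable).ennreal_ofReal

theorem IsWeight.jointDensity_ne_zero_iff (hρ : IsWeight X ρ) (W : Matrix (Fin m) (Fin m) ℝ)
    (n : ℕ) (y : EuclideanSpace ℝ (ActiveIdx m n)) (z : EuclideanSpace ℝ (InactiveIdx m n)) :
    jointDensity W n ρ y z ≠ 0 ↔ z ∈ {z | fromCoords W n y z ∈ X} := by
  rw [jointDensity, Ne, ENNReal.ofReal_eq_zero, not_le]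
  refine ⟨fun h => ?_, fun h => hρ.pos _ h⟩
  by_contra hz
  exact h.ne' (hρ.zero _ hz)

theorem convex_slice (hX : Convex ℝ X) (W : Matrix (Fin m) (Fin m) ℝ) (n : ℕ)
    (y : EuclideanSpace ℝ (ActiveIdx m n)) : Convex ℝ {z | fromCoords W n y z ∈ X} := by
  refine convex_iff_segment_subset.2 fun z hz z' hz' => ?_
  rw [segment_eq_image_lineMap]
  rintro _ ⟨t, ht, rfl⟩
  rw [Set.mem_ofPred_eq, fromCoords_lineMap]
  exact hX.segment_subset hz hz' (by rw [segment_eq_image_lineMap]; exact ⟨t, ht, rfl⟩)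

/-- One constant must serve all n < m; the sum of the `c n` dominates each of them. -/
theorem poincareConstant_ne_top_of_forall (c : ℕ → ℝ≥0∞) (hc : ∀ n, c n ≠ ∞)
    (h : ∀ n, ∀ W ∈ Matrix.orthogonalGroup (Fin m) ℝ, ∀ y : EuclideanSpace ℝ (ActiveIdx m n),
      SatisfiesPoincare {z | fromCoords W n y z ∈ X} (condMeasure W n ρ y) (c n)) :
    poincareConstant X ρ ≠ ∞ := by
  have hs : ∑ n ∈ Finset.range m, c n ≠ ∞ := (ENNReal.sum_lt_top.2 fun n _ => (hc n).lt_top).ne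
  refine ne_top_of_le_ne_top hs (sInf_le fun n hn W hW => ae_of_all _ fun y => ?_)
  exact (h n W hW y).mono (Finset.single_le_sum (f := c) (fun _ _ => zero_le)
    (Finset.mem_range.2 hn))

theorem IsWeight.poincareConstant_ne_top_of_convex (hρ : IsWeight X ρ) (hX : Convex ℝ X)
    (hb : Bornology.IsBounded X) {c : ℝ} (hc : 0 < c) (hcρ : ∀ x ∈ X, c ≤ ρ x) :
    poincareConstant X ρ ≠ ∞ := by
  obtain ⟨B, hB⟩ := hρ.bounded
  obtain ⟨D, hD⟩ := Metric.isBounded_iff.1 hb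
  refine poincareConstant_ne_top_of_forall (fun n => 2 ^ (Fintype.card (InactiveIdx m n) + 3) *
    (ENNReal.ofReal D ^ 2 * ENNReal.ofReal (B / c))) (fun n => by finiteness) fun n W hW y => ?_
  refine satisfiesPoincare_of_bounded_convex (convex_slice hX W n y)
    (measurable_jointDensity hρ.measurable W n y) (hρ.jointDensity_ne_zero_iff W n y)
    (fun z => ENNReal.ofReal_ne_top) (fun u hu v hv => ?_) fun u hu v hv => ?_
  -- The slice embeds isometrically into `X`, so its diameter is at most `D`.
  · have h := hD hu hv
    rw [dist_eq_norm, fromCoords_eq_add W n y u, fromCoords_eq_add W n y v,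
      add_sub_add_right_eq_sub, ← map_sub, norm_lastColsMap hW] at h
    rw [← ofReal_norm]
    exact ENNReal.ofReal_le_ofReal h
  · have hu' : ρ (fromCoords W n y u) ≤ B := hB _
    have hv' : c ≤ ρ (fromCoords W n y v) := hcρ _ hv
    have hB0 : 0 < B := (hρ.pos _ hu).trans_le hu'
    rw [jointDensity, jointDensity, ← ENNReal.ofReal_mul (by positivity)]
    refine ENNReal.ofReal_le_ofReal (hu'.trans ?_)
    calc B = B / c * c := by field_simp
      _ ≤ _ := by gcongr

theorem IsWeight.poincareConstant_ne_top_of_gaussian (hρ : IsWeight Set.univ ρ) {κ c₁ c₂ : ℝ}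
    (hκ : 0 < κ) (hc₁ : 0 < c₁)
    (h : ∀ x, c₁ * Real.exp (-κ * ‖x‖ ^ 2) ≤ ρ x ∧ ρ x ≤ c₂ * Real.exp (-κ * ‖x‖ ^ 2)) :
    poincareConstant Set.univ ρ ≠ ∞ := by
  have hc₂ : 0 < c₂ := by
    have := (h 0).1.trans (h 0).2
    simp only [norm_zero] at this
    exact hc₁.trans_le (le_of_mul_le_mul_right this (Real.exp_pos _))
  refine poincareConstant_ne_top_of_forall (fun n => 2 ^ (Fintype.card (InactiveIdx m n) + 3) *
    (ENNReal.ofReal ((c₂ / c₁) ^ 2 * (44 / κ)) *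
      ((∫⁻ z : EuclideanSpace ℝ (InactiveIdx m n),
          ENNReal.ofReal (Real.exp (-(κ / 20) * ‖z‖ ^ 2))) /
        ∫⁻ z : EuclideanSpace ℝ (InactiveIdx m n), ENNReal.ofReal (Real.exp (-κ * ‖z‖ ^ 2)))))
    (fun n => ?_) fun n W hW y => ?_
  · have h1 := ENNReal.div_ne_top
      (lintegral_gaussian_ne_top (ι := InactiveIdx m n) (show 0 < κ / 20 by positivity))
      (lintegral_gaussian_ne_zero (ι := InactiveIdx m n) κ)
    finiteness
  -- By Pythagoras the Gaussian factorises, and fixing y only changes its scale.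
  · have hexp : ∀ z, Real.exp (-κ * ‖fromCoords W n y z‖ ^ 2) =
        Real.exp (-κ * ‖y‖ ^ 2) * Real.exp (-κ * ‖z‖ ^ 2) := by
      intro z
      rw [norm_fromCoords_sq hW, mul_add, Real.exp_add]
    have hs := satisfiesPoincare_of_gaussian_bounds (p := jointDensity W n ρ y)
      (measurable_jointDensity hρ.measurable W n y) hκ
      (show 0 < c₁ * Real.exp (-κ * ‖y‖ ^ 2) by positivity) (show 0 < c₂ / c₁ by positivity)
      (fun z => ENNReal.ofReal_le_ofReal (by
        have := (h (fromCoords W n y z)).1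
        rw [hexp] at this
        linarith))
      (fun z => ENNReal.ofReal_le_ofReal (by
        have := (h (fromCoords W n y z)).2
        rw [hexp] at this
        rw [← mul_assoc, div_mul_cancel₀ _ hc₁.ne']
        linarith))
    simp only [Set.mem_univ, Set.ofPred_true]
    exact hs

end Finiteness

/-! ### Independent samples -/

section Samples

variable {α : Type*} [MeasurableSpace α]

/-- Tonelli, by splitting off one coordinate at a time. -/
theorem lintegral_pi_prod (μ : Measure α) [SigmaFinite μ] {N : ℕ} {f : Fin N → α → ℝ≥0∞}
    (hf : ∀ i, Measurable (f i)) :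
    ∫⁻ z, ∏ i, f i (z i) ∂(Measure.pi fun _ => μ) = ∏ i, ∫⁻ a, f i a ∂μ := by
  induction N with
  | zero => simp
  | succ N ih =>
    have h := (measurePreserving_piFinSuccAbove (fun _ : Fin (N + 1) => μ) 0).symm
    rw [← h.lintegral_comp_emb (MeasurableEquiv.measurableEmbedding _), lintegral_prod]
    · simp only [Fin.prod_univ_succ]
      rw [← ih fun i => hf i.succ, ← lintegral_mul_const _ (hf 0)]
      refine lintegral_congr fun a => ?_
      rw [← lintegral_const_mul _ (Finset.measurable_fun_prod _ fun i _ =>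
        (hf i.succ).comp (measurable_pi_apply i))]
      rfl
    · exact ((Finset.measurable_fun_prod _ fun i _ => (hf i).comp (measurable_pi_apply i)).comp
        (MeasurableEquiv.measurable _)).aemeasurable

theorem pi_withDensity (μ : Measure α) [SigmaFinite μ] {q : α → ℝ≥0∞} (hq : Measurable q)
    [SigmaFinite (μ.withDensity q)] (N : ℕ) :
    Measure.pi (fun _ : Fin N => μ.withDensity q) =
      (Measure.pi fun _ : Fin N => μ).withDensity fun z => ∏ i, q (z i) := by
  refine Measure.pi_eq fun s hs => ?_
  rw [withDensity_apply _ (MeasurableSet.univ_pi hs), ← lintegral_indicator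
    (MeasurableSet.univ_pi hs)]
  have h : ∀ z : Fin N → α, (Set.univ.pi s).indicator (fun z => ∏ i, q (z i)) z =
      ∏ i, (s i).indicator q (z i) := by
    intro z
    by_cases hz : z ∈ Set.univ.pi s
    · rw [Set.indicator_of_mem hz]
      exact Finset.prod_congr rfl fun i _ => (Set.indicator_of_mem (hz i trivial) q).symm
    · rw [Set.indicator_of_notMem hz]
      simp only [Set.mem_pi, Set.mem_univ, true_imp_iff, not_forall] at hz
      obtain ⟨i, hi⟩ := hz
      exact (Finset.prod_eq_zero (Finset.mem_univ i) (Set.indicator_of_notMem hi q)).symm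
  simp only [h]
  rw [lintegral_pi_prod μ fun i => hq.indicator (hs i)]
  refine Finset.prod_congr rfl fun i _ => ?_
  rw [withDensity_apply _ (hs i), lintegral_indicator (hs i)]

/-- The decomposition of a mean squared error into squared bias and variance. -/
theorem lintegral_const_sub_sq {μ : Measure α} [IsProbabilityMeasure μ] {Y : α → ℝ}
    (hY : MemLp Y 2 μ) (c : ℝ) :
    ∫⁻ a, ‖(c - Y a) ^ 2‖ₑ ∂μ = ENNReal.ofReal ((c - μ[Y]) ^ 2 + Var[Y; μ]) := by
  have hc : MemLp (fun a => c - Y a) 2 μ := (memLp_const c).sub hY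
  have hi : Integrable (fun a => (c - Y a) ^ 2) μ := hc.integrable_sq
  have h1 := variance_eq_sub hc
  rw [variance_const_sub hY.aestronglyMeasurable, integral_sub (integrable_const _)
    (hY.integrable (by norm_num))] at h1
  simp only [Pi.pow_apply, integral_const, probReal_univ, one_smul] at h1
  rw [h1, add_sub_cancel, ofReal_integral_eq_lintegral_ofReal hi
    (ae_of_all _ fun a => sq_nonneg _)]
  exact lintegral_congr fun a => Real.enorm_of_nonneg (sq_nonneg _)

/-- The mean squared difference of a value and the mean of `N` other independent values. -/
theorem lintegral_sub_sampleMean_sq {ν : Measure α} [IsProbabilityMeasure ν] {g : α → ℝ}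
    (hg : MemLp g 2 ν) {N : ℕ} (hN : 1 ≤ N) :
    ∫⁻ a, ∫⁻ z, ‖(g a - (1 / (N : ℝ)) * ∑ i, g (z i)) ^ 2‖ₑ
      ∂(Measure.pi fun _ : Fin N => ν) ∂ν = ENNReal.ofReal (1 + 1 / N) * evariance g ν := by
  have hN0 : (N : ℝ) ≠ 0 := by positivity
  set P := Measure.pi fun _ : Fin N => ν with hP
  have hgi : ∀ i : Fin N, MemLp (fun z : Fin N → α => g (z i)) 2 P := fun i =>
    hg.comp_measurePreserving (measurePreserving_eval (fun _ : Fin N => ν) i)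
  have hsum : MemLp (fun z : Fin N → α => ∑ i, g (z i)) 2 P := memLp_finsetSum _ fun i _ => hgi i
  set Y : (Fin N → α) → ℝ := fun z => (1 / (N : ℝ)) * ∑ i, g (z i) with hYdef
  have hY : MemLp Y 2 P := hsum.const_mul _
  have hmean : P[Y] = ν[g] := by
    have h1 : ∀ i : Fin N, ∫ z, g (z i) ∂P = ∫ a, g a ∂ν := fun i =>
      integral_comp_eval (μ := fun _ : Fin N => ν) hg.aestronglyMeasurable
    rw [hYdef, integral_const_mul, integral_finsetSum _ fun i _ => (hgi i).integrable (by norm_num)]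
    simp only [h1, Finset.sum_const, Finset.card_univ, Fintype.card_fin, nsmul_eq_mul]
    field_simp
  have hvar : Var[Y; P] = 1 / N * Var[g; ν] := by
    have h1 : Var[fun z : Fin N → α => ∑ i, g (z i); P] = N * Var[g; ν] := by
      have := variance_sum_pi (μ := fun _ : Fin N => ν) (X := fun _ => g) fun _ => hg
      rw [show (fun z : Fin N → α => ∑ i, g (z i)) = ∑ i, fun z : Fin N → α => g (z i) by
        ext z; simp, this]
      simp
    rw [hYdef, variance_const_mul, h1]
    field_simp
  -- For fixed a, the sample mean has the mean of g and variance Var(g)/N. Averaging the squared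
  -- bias over a contributes one more Var(g).
  calc ∫⁻ a, ∫⁻ z, ‖(g a - Y z) ^ 2‖ₑ ∂P ∂ν
      = ∫⁻ a, (‖g a - ν[g]‖ₑ ^ 2 + ENNReal.ofReal (1 / N * Var[g; ν])) ∂ν := by
        refine lintegral_congr fun a => ?_
        rw [lintegral_const_sub_sq hY, hmean, hvar, ENNReal.ofReal_add (sq_nonneg _)
          (mul_nonneg (by positivity) (variance_nonneg _ _)), ← Real.enorm_of_nonneg (sq_nonneg _),
          enorm_pow]
    _ = evariance g ν + ENNReal.ofReal (1 / N) * evariance g ν := by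
        rw [lintegral_add_right _ measurable_const, lintegral_const, measure_univ, mul_one,
          ENNReal.ofReal_mul (by positivity), hg.ofReal_variance_eq]
        rfl
    _ = ENNReal.ofReal (1 + 1 / N) * evariance g ν := by
        rw [ENNReal.ofReal_add zero_le_one (by positivity), add_mul, ENNReal.ofReal_one, one_mul]

end Samples

/-! ### Disintegration in rotated coordinates -/

section Disintegration

variable {m : ℕ} {X : Set (EuclideanSpace ℝ (Fin m))} {ρ : EuclideanSpace ℝ (Fin m) → ℝ}
  {W : Matrix (Fin m) (Fin m) ℝ} {n : ℕ}

theorem measurable_marginalDensity (hρ : Measurable ρ) (W : Matrix (Fin m) (Fin m) ℝ) (n : ℕ) :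
    Measurable (marginalDensity W n ρ) :=
  (measurable_jointDensity_uncurry hρ W n).lintegral_prod_right'

theorem measurable_condDensity_uncurry (hρ : Measurable ρ) (W : Matrix (Fin m) (Fin m) ℝ) (n : ℕ) :
    Measurable fun q : EuclideanSpace ℝ (ActiveIdx m n) × EuclideanSpace ℝ (InactiveIdx m n) =>
      condDensity W n ρ q.1 q.2 :=
  (measurable_jointDensity_uncurry hρ W n).div
    ((measurable_marginalDensity hρ W n).comp measurable_fst)

theorem measurable_condDensity (hρ : Measurable ρ) (W : Matrix (Fin m) (Fin m) ℝ) (n : ℕ)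
    (y : EuclideanSpace ℝ (ActiveIdx m n)) : Measurable (condDensity W n ρ y) :=
  (measurable_jointDensity hρ W n y).div_const _

/-- The product M·M⁻¹ is left unsimplified: it is 0 when M is 0 or ∞ and 1 otherwise, so the
conditional measure is finite for every y. -/
theorem lintegral_condDensity (hρ : Measurable ρ) (W : Matrix (Fin m) (Fin m) ℝ) (n : ℕ)
    (y : EuclideanSpace ℝ (ActiveIdx m n)) :
    ∫⁻ z, condDensity W n ρ y z = marginalDensity W n ρ y * (marginalDensity W n ρ y)⁻¹ :=
  lintegral_mul_const _ (measurable_jointDensity hρ W n y)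

theorem isFiniteMeasure_condMeasure (hρ : Measurable ρ) (W : Matrix (Fin m) (Fin m) ℝ) (n : ℕ)
    (y : EuclideanSpace ℝ (ActiveIdx m n)) : IsFiniteMeasure (condMeasure W n ρ y) := by
  refine isFiniteMeasure_withDensity ?_
  rw [lintegral_condDensity hρ]
  exact ((ENNReal.mul_inv_le_one _).trans_lt ENNReal.one_lt_top).ne

theorem isProbabilityMeasure_condMeasure (hρ : Measurable ρ)
    {y : EuclideanSpace ℝ (ActiveIdx m n)} (h0 : marginalDensity W n ρ y ≠ 0)
    (htop : marginalDensity W n ρ y ≠ ∞) : IsProbabilityMeasure (condMeasure W n ρ y) := by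
  constructor
  rw [condMeasure, withDensity_apply _ MeasurableSet.univ, Measure.restrict_univ,
    lintegral_condDensity hρ, ENNReal.mul_inv_cancel h0 htop]

theorem condMeasure_eq_zero (hρ : Measurable ρ) {y : EuclideanSpace ℝ (ActiveIdx m n)}
    (h0 : marginalDensity W n ρ y = 0) : condMeasure W n ρ y = 0 := by
  rw [← Measure.measure_univ_eq_zero, condMeasure, withDensity_apply _ MeasurableSet.univ,
    Measure.restrict_univ, lintegral_condDensity hρ, h0, zero_mul]

theorem lintegral_fromCoords (hW : W ∈ Matrix.orthogonalGroup (Fin m) ℝ) (n : ℕ)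
    {F : EuclideanSpace ℝ (Fin m) → ℝ≥0∞} (hF : Measurable F) :
    ∫⁻ x, F x = ∫⁻ y : EuclideanSpace ℝ (ActiveIdx m n), ∫⁻ z, F (fromCoords W n y z) := by
  rw [← (measurePreserving_fromCoords hW n).lintegral_comp hF, Measure.volume_eq_prod, lintegral_prod]
  exact (hF.comp (continuous_fromCoords W n).measurable).aemeasurable

theorem lintegral_marginalDensity (hρ : IsWeight X ρ) (hW : W ∈ Matrix.orthogonalGroup (Fin m) ℝ)
    (n : ℕ) : ∫⁻ y, marginalDensity W n ρ y = 1 := by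
  rw [← hρ.mass, lintegral_fromCoords hW n hρ.measurable.ennreal_ofReal]
  rfl

theorem ae_marginalDensity_ne_top (hρ : IsWeight X ρ)
    (hW : W ∈ Matrix.orthogonalGroup (Fin m) ℝ) (n : ℕ) :
    ∀ᵐ y, marginalDensity W n ρ y ≠ ∞ := by
  filter_upwards [ae_lt_top (measurable_marginalDensity hρ.measurable W n)
    (by rw [lintegral_marginalDensity hρ hW]; exact ENNReal.one_ne_top)] with y hy using hy.ne

theorem lintegral_jointDensity_mul (hρ : Measurable ρ) {y : EuclideanSpace ℝ (ActiveIdx m n)}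
    (htop : marginalDensity W n ρ y ≠ ∞) (F : EuclideanSpace ℝ (InactiveIdx m n) → ℝ≥0∞) :
    ∫⁻ z, jointDensity W n ρ y z * F z =
      marginalDensity W n ρ y * ∫⁻ z, F z ∂(condMeasure W n ρ y) := by
  by_cases h0 : marginalDensity W n ρ y = 0
  · rw [h0, zero_mul]
    refine lintegral_eq_zero_of_ae_eq_zero ?_
    filter_upwards [(lintegral_eq_zero_iff (measurable_jointDensity hρ W n y)).1 h0] with z hz
    simp only [Pi.zero_apply] at hz ⊢
    rw [hz, zero_mul]
  · rw [condMeasure, lintegral_withDensity_eq_lintegral_mul_non_measurable _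
      (measurable_condDensity hρ W n y)
      (ae_of_all _ fun z => ENNReal.div_lt_top ENNReal.ofReal_ne_top h0),
      ← lintegral_const_mul' _ _ htop]
    refine lintegral_congr fun z => ?_
    rw [Pi.mul_apply, ← mul_assoc, condDensity, ENNReal.mul_div_cancel h0 htop]

theorem lintegral_weightMeasure (hρ : IsWeight X ρ) (hW : W ∈ Matrix.orthogonalGroup (Fin m) ℝ)
    (n : ℕ) {F : EuclideanSpace ℝ (Fin m) → ℝ≥0∞} (hF : Measurable F) :
    ∫⁻ x, F x ∂(weightMeasure ρ) = ∫⁻ y, marginalDensity W n ρ y *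
      ∫⁻ z, F (fromCoords W n y z) ∂(condMeasure W n ρ y) := by
  rw [weightMeasure, lintegral_withDensity_eq_lintegral_mul _ hρ.measurable.ennreal_ofReal hF,
    lintegral_fromCoords hW n (hρ.measurable.ennreal_ofReal.mul hF)]
  refine lintegral_congr_ae ?_
  filter_upwards [ae_marginalDensity_ne_top hρ hW n] with y hy
  exact lintegral_jointDensity_mul hρ.measurable hy _

theorem measurable_lintegral_condMeasure (hρ : Measurable ρ) (W : Matrix (Fin m) (Fin m) ℝ) (n : ℕ)
    {F : EuclideanSpace ℝ (Fin m) → ℝ≥0∞} (hF : Measurable F) :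
    Measurable fun y => ∫⁻ z, F (fromCoords W n y z) ∂(condMeasure W n ρ y) := by
  have h : ∀ y, ∫⁻ z, F (fromCoords W n y z) ∂(condMeasure W n ρ y) =
      ∫⁻ z, condDensity W n ρ y z * F (fromCoords W n y z) := fun y =>
    lintegral_withDensity_eq_lintegral_mul _ (measurable_condDensity hρ W n y)
      (hF.comp ((continuous_fromCoords W n).comp (Continuous.prodMk_right y)).measurable)
  simp only [h]
  exact ((measurable_condDensity_uncurry hρ W n).mul
    (hF.comp (continuous_fromCoords W n).measurable)).lintegral_prod_right'

theorem ae_lintegral_condMeasure_lt_top (hρ : IsWeight X ρ)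
    (hW : W ∈ Matrix.orthogonalGroup (Fin m) ℝ) (n : ℕ)
    {F : EuclideanSpace ℝ (Fin m) → ℝ≥0∞} (hF : Measurable F)
    (hfin : ∫⁻ x, F x ∂(weightMeasure ρ) ≠ ∞) :
    ∀ᵐ y, ∫⁻ z, F (fromCoords W n y z) ∂(condMeasure W n ρ y) < ∞ := by
  rw [lintegral_weightMeasure hρ hW n hF] at hfin
  filter_upwards [ae_lt_top ((measurable_marginalDensity hρ.measurable W n).mul
    (measurable_lintegral_condMeasure hρ.measurable W n hF)) hfin] with y hy
  by_cases h0 : marginalDensity W n ρ y = 0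
  · simp [condMeasure_eq_zero hρ.measurable h0]
  · exact ENNReal.lt_top_of_mul_ne_top_right hy.ne h0

theorem ae_ae_fromCoords (hW : W ∈ Matrix.orthogonalGroup (Fin m) ℝ) (n : ℕ)
    {P : EuclideanSpace ℝ (Fin m) → Prop} (hP : ∀ᵐ x, P x) :
    ∀ᵐ y : EuclideanSpace ℝ (ActiveIdx m n), ∀ᵐ z, P (fromCoords W n y z) :=
  Measure.ae_ae_of_ae_prod ((measurePreserving_fromCoords hW n).quasiMeasurePreserving.ae hP)

/-- Since ρ is positive exactly on `X`, its null sets are those that meet `X` in a Lebesgue null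
set. -/
theorem ae_weightMeasure_iff (hρ : IsWeight X ρ) {P : EuclideanSpace ℝ (Fin m) → Prop} :
    (∀ᵐ x ∂(weightMeasure ρ), P x) ↔ ∀ᵐ x, x ∈ X → P x := by
  rw [weightMeasure, ae_withDensity_iff hρ.measurable.ennreal_ofReal]
  refine Filter.eventually_congr (ae_of_all _ fun x => ?_)
  have : ENNReal.ofReal (ρ x) ≠ 0 ↔ x ∈ X := by
    rw [Ne, ENNReal.ofReal_eq_zero, not_le]
    refine ⟨fun h => ?_, hρ.pos x⟩
    by_contra hx
    exact h.ne' (hρ.zero x hx)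
  rw [this]

theorem ae_condMeasure_of_ae (hρ : IsWeight X ρ) {y : EuclideanSpace ℝ (ActiveIdx m n)}
    {P : EuclideanSpace ℝ (InactiveIdx m n) → Prop}
    (hP : ∀ᵐ z, fromCoords W n y z ∈ X → P z) : ∀ᵐ z ∂(condMeasure W n ρ y), P z := by
  rw [condMeasure, ae_withDensity_iff (measurable_condDensity hρ.measurable W n y)]
  filter_upwards [hP] with z hz hq
  refine hz ((hρ.jointDensity_ne_zero_iff W n y z).1 fun h => hq ?_)
  rw [condDensity, h, ENNReal.zero_div]

theorem ae_ae_condMeasure (hρ : IsWeight X ρ) (hW : W ∈ Matrix.orthogonalGroup (Fin m) ℝ) (n : ℕ)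
    {P : EuclideanSpace ℝ (Fin m) → Prop} (hP : ∀ᵐ x ∂(weightMeasure ρ), P x) :
    ∀ᵐ y, ∀ᵐ z ∂(condMeasure W n ρ y), P (fromCoords W n y z) := by
  filter_upwards [ae_ae_fromCoords hW n ((ae_weightMeasure_iff hρ).1 hP)] with y hy
  exact ae_condMeasure_of_ae hρ hy

theorem measurable_sampleDensity (hρ : Measurable ρ) (W : Matrix (Fin m) (Fin m) ℝ) (n N : ℕ) :
    Measurable fun p : EuclideanSpace ℝ (Fin m) × (Fin N → EuclideanSpace ℝ (InactiveIdx m n)) =>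
      ENNReal.ofReal (ρ p.1) * ∏ i, condDensity W n ρ (activeCoord W n p.1) (p.2 i) := by
  have h1 : Measurable fun p : EuclideanSpace ℝ (Fin m) ×
      (Fin N → EuclideanSpace ℝ (InactiveIdx m n)) => ENNReal.ofReal (ρ p.1) :=
    (hρ.comp measurable_fst).ennreal_ofReal
  have h2 : ∀ i, Measurable fun p : EuclideanSpace ℝ (Fin m) ×
      (Fin N → EuclideanSpace ℝ (InactiveIdx m n)) => (activeCoord W n p.1, p.2 i) := fun i =>
    ((continuous_activeCoord W n).measurable.comp measurable_fst).prodMk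
      ((measurable_pi_apply i).comp measurable_snd)
  have h3 : ∀ i, Measurable fun p : EuclideanSpace ℝ (Fin m) ×
      (Fin N → EuclideanSpace ℝ (InactiveIdx m n)) =>
        condDensity W n ρ (activeCoord W n p.1) (p.2 i) := by
    intro i
    have h := Measurable.comp (g := fun q : EuclideanSpace ℝ (ActiveIdx m n) ×
      EuclideanSpace ℝ (InactiveIdx m n) => condDensity W n ρ q.1 q.2)
      (measurable_condDensity_uncurry hρ W n) (h2 i)
    simpa only [Function.comp_def] using h
  exact h1.mul (Finset.measurable_fun_prod _ fun i _ => h3 i)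

/-- In the coordinates (y, z₀) of x, the sampling density depends on x through y alone. So z₀ is one
more independent draw from the conditional law of the samples. -/
theorem lintegral_sampleLaw (hρ : IsWeight X ρ) (hW : W ∈ Matrix.orthogonalGroup (Fin m) ℝ)
    (n N : ℕ) {h : EuclideanSpace ℝ (Fin m) × (Fin N → EuclideanSpace ℝ (InactiveIdx m n)) → ℝ≥0∞}
    (hh : Measurable h) :
    ∫⁻ p, h p ∂(sampleLaw W n N ρ) = ∫⁻ y, marginalDensity W n ρ y *
      ∫⁻ z₀, ∫⁻ z, h (fromCoords W n y z₀, z)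
        ∂(Measure.pi fun _ => condMeasure W n ρ y) ∂(condMeasure W n ρ y) := by
  have hD := measurable_sampleDensity hρ.measurable W n N
  rw [sampleLaw, lintegral_withDensity_eq_lintegral_mul _ hD hh, Measure.volume_eq_prod,
    lintegral_prod _ (hD.mul hh).aemeasurable,
    lintegral_fromCoords hW n (hD.mul hh).lintegral_prod_right']
  refine lintegral_congr_ae ?_
  filter_upwards [ae_marginalDensity_ne_top hρ hW n] with y hy
  rw [← lintegral_jointDensity_mul hρ.measurable hy]
  refine lintegral_congr fun z₀ => ?_
  have hq := measurable_condDensity hρ.measurable W n y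
  have hfin := isFiniteMeasure_condMeasure hρ.measurable W n y
  unfold condMeasure at hfin ⊢
  have hprod : Measurable fun z : Fin N → EuclideanSpace ℝ (InactiveIdx m n) =>
      ∏ i, condDensity W n ρ y (z i) :=
    Finset.measurable_fun_prod _ fun i _ => hq.comp (measurable_pi_apply i)
  have hh' : Measurable fun z => h (fromCoords W n y z₀, z) := hh.comp measurable_prodMk_left
  have hjt : jointDensity W n ρ y z₀ ≠ ∞ := ENNReal.ofReal_ne_top
  rw [pi_withDensity volume hq N, lintegral_withDensity_eq_lintegral_mul _ hprod hh', ← lintegral_const_mul' _ _ hjt, volume_pi]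
  refine lintegral_congr fun z => ?_
  simp only [Pi.mul_apply, activeCoord_fromCoords hW, jointDensity, mul_assoc]

/-- Given y, both z₀ and each sample follow the conditional law, so a set that is null for ρ is
almost surely avoided by x and by all sampled points. Hence f may be replaced by a measurable
representative inside `monteCarlo`. -/
theorem ae_sampleLaw (hρ : IsWeight X ρ) (hW : W ∈ Matrix.orthogonalGroup (Fin m) ℝ)
    (n N : ℕ) {P : EuclideanSpace ℝ (Fin m) → Prop} (hP : ∀ᵐ x ∂(weightMeasure ρ), P x) :
    ∀ᵐ p ∂(sampleLaw W n N ρ),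
      P p.1 ∧ ∀ i, P (fromCoords W n (activeCoord W n p.1) (p.2 i)) := by
  obtain ⟨B, hPB, hB, hB0⟩ := exists_measurable_superset_of_null hP
  have hnull : ∀ᵐ x ∂(weightMeasure ρ), x ∉ B := measure_eq_zero_iff_ae_notMem.1 hB0
  have hBP : ∀ x, x ∉ B → P x := fun x hx => by
    by_contra h
    exact hx (hPB h)
  have hslice := ae_ae_condMeasure hρ hW n hnull
  have hmi : ∀ i : Fin N, Measurable fun p : EuclideanSpace ℝ (Fin m) ×
      (Fin N → EuclideanSpace ℝ (InactiveIdx m n)) =>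
        fromCoords W n (activeCoord W n p.1) (p.2 i) := fun i =>
    (continuous_fromCoords W n).measurable.comp
      (((continuous_activeCoord W n).measurable.comp measurable_fst).prodMk
        ((measurable_pi_apply i).comp measurable_snd))
  have h1 : ∀ᵐ p ∂(sampleLaw W n N ρ), p.1 ∉ B := by
    suffices h : sampleLaw W n N ρ (Prod.fst ⁻¹' B) = 0 from measure_eq_zero_iff_ae_notMem.1 h
    rw [← lintegral_indicator_one (measurable_fst hB), lintegral_sampleLaw hρ hW n N (measurable_one.indicator
      (measurable_fst hB))]
    refine lintegral_eq_zero_of_ae_eq_zero ?_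
    filter_upwards [hslice] with y hy
    simp only [Pi.zero_apply, mul_eq_zero]
    refine Or.inr (lintegral_eq_zero_of_ae_eq_zero ?_)
    filter_upwards [hy] with z₀ hz₀
    simp [Set.indicator_of_notMem, hz₀]
  have h2 : ∀ i, ∀ᵐ p ∂(sampleLaw W n N ρ),
      fromCoords W n (activeCoord W n p.1) (p.2 i) ∉ B := by
    intro i
    suffices h : sampleLaw W n N ρ ((fun p => fromCoords W n (activeCoord W n p.1) (p.2 i)) ⁻¹' B)
      = 0 from measure_eq_zero_iff_ae_notMem.1 h
    rw [← lintegral_indicator_one (hmi i hB), lintegral_sampleLaw hρ hW n N (measurable_one.indicator (hmi i hB))]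
    refine lintegral_eq_zero_of_ae_eq_zero ?_
    filter_upwards [hslice] with y hy
    simp only [Pi.zero_apply, mul_eq_zero]
    refine Or.inr (lintegral_eq_zero_of_ae_eq_zero (ae_of_all _ fun z₀ => ?_))
    have hfin := isFiniteMeasure_condMeasure hρ.measurable W n y
    have h3 : ∀ᵐ z ∂(Measure.pi fun _ : Fin N => condMeasure W n ρ y),
        fromCoords W n y (z i) ∉ B :=
      (Measure.tendsto_eval_ae_ae (μ := fun _ : Fin N => condMeasure W n ρ y) (i := i)).eventually hy
    refine lintegral_eq_zero_of_ae_eq_zero ?_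
    filter_upwards [h3] with z hz
    refine Set.indicator_of_notMem ?_ _
    simpa only [Set.mem_preimage, activeCoord_fromCoords hW] using hz
  filter_upwards [h1, ae_all_iff.2 h2] with p hp1 hp2
  exact ⟨hBP _ hp1, fun i => hBP _ (hp2 i)⟩

end Disintegration

/-! ### Gradients on slices -/

section Gradients

variable {m : ℕ} {X : Set (EuclideanSpace ℝ (Fin m))} {ρ f : EuclideanSpace ℝ (Fin m) → ℝ}
  {W : Matrix (Fin m) (Fin m) ℝ} {n : ℕ}

/-- The coordinates `z = W₂ᵀ x`. -/
def inactiveCoord (W : Matrix (Fin m) (Fin m) ℝ) (n : ℕ) (x : EuclideanSpace ℝ (Fin m)) :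
    EuclideanSpace ℝ (InactiveIdx m n) :=
  WithLp.toLp 2 ((lastCols W n).transpose.mulVec x.ofLp)

theorem continuous_inactiveCoord (W : Matrix (Fin m) (Fin m) ℝ) (n : ℕ) :
    Continuous (inactiveCoord W n) := by
  unfold inactiveCoord
  fun_prop

theorem inner_inactiveCoord (W : Matrix (Fin m) (Fin m) ℝ) (n : ℕ) (x : EuclideanSpace ℝ (Fin m))
    (z : EuclideanSpace ℝ (InactiveIdx m n)) :
    inner ℝ (inactiveCoord W n x) z = inner ℝ x (lastColsMap W n z) := by
  have h1 : inner ℝ (inactiveCoord W n x) z =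
      z.ofLp ⬝ᵥ (lastCols W n).transpose.mulVec x.ofLp := rfl
  have h2 : inner ℝ x (lastColsMap W n z) = (lastCols W n).mulVec z.ofLp ⬝ᵥ x.ofLp := rfl
  rw [h1, h2, Matrix.dotProduct_mulVec, Matrix.vecMul_transpose]

/-- Chain rule: the adjoint of z ↦ W₂z is W₂ᵀ. -/
theorem hasGradientAt_slice {y : EuclideanSpace ℝ (ActiveIdx m n)}
    {z : EuclideanSpace ℝ (InactiveIdx m n)} (hf : DifferentiableAt ℝ f (fromCoords W n y z)) :
    HasGradientAt (fun z => f (fromCoords W n y z))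
      (inactiveCoord W n (∇ f (fromCoords W n y z))) z := by
  rw [hasGradientAt_iff_hasFDerivAt]
  have h1 : HasFDerivAt (fun z => fromCoords W n y z) (lastColsMap W n) z := by
    have : (fun z => fromCoords W n y z) = fun z => lastColsMap W n z + fromCoords W n y 0 :=
      funext fun z => fromCoords_eq_add W n y z
    rw [this]
    exact (lastColsMap W n).hasFDerivAt.add_const _
  have h2 := hf.hasGradientAt.hasFDerivAt.comp z h1
  refine h2.congr_fderiv ?_
  ext w
  simp only [ContinuousLinearMap.comp_apply, InnerProductSpace.toDual_apply_apply,
    inner_inactiveCoord]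

theorem IsAbsCont.slice (hf : IsAbsCont f X) (hW : W ∈ Matrix.orthogonalGroup (Fin m) ℝ) (n : ℕ) :
    ∀ᵐ y : EuclideanSpace ℝ (ActiveIdx m n),
      IsAbsCont (fun z => f (fromCoords W n y z)) {z | fromCoords W n y z ∈ X} ∧
      ∀ᵐ z, fromCoords W n y z ∈ X → ∇ (fun z => f (fromCoords W n y z)) z =
        inactiveCoord W n (∇ f (fromCoords W n y z)) := by
  filter_upwards [ae_ae_fromCoords hW n hf.differentiable] with y hy
  refine ⟨⟨fun a b hab => ?_, ?_⟩, ?_⟩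
  · simp only [fromCoords_lineMap]
    refine hf.along_segments _ _ ?_
    rw [segment_eq_image_lineMap] at hab ⊢
    rintro _ ⟨t, ht, rfl⟩
    rw [← fromCoords_lineMap]
    exact hab ⟨t, ht, rfl⟩
  · filter_upwards [hy] with z hz hzX
    exact (hasGradientAt_slice (hz hzX)).differentiableAt
  · filter_upwards [hy] with z hz hzX
    exact (hasGradientAt_slice (hz hzX)).gradient

theorem IsWeight.measurableSet (hρ : IsWeight X ρ) : MeasurableSet X := by
  have : X = {x | 0 < ρ x} := by
    ext x
    refine ⟨hρ.pos x, fun h => ?_⟩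
    by_contra hx
    exact (ne_of_gt h) (hρ.zero x hx)
  rw [this]
  exact measurableSet_lt measurable_const hρ.measurable

/-- The gradient of a function that is differentiable almost everywhere on a measurable set is
measurable there, even when the function is not. -/
theorem aemeasurable_gradient_restrict (hX : MeasurableSet X)
    (hf : ∀ᵐ x, x ∈ X → DifferentiableAt ℝ f x) : AEMeasurable (∇ f) (volume.restrict X) := by
  rcases subsingleton_or_nontrivial (EuclideanSpace ℝ (Fin m)) with hE | hE
  · exact (measurable_of_subsingleton_codomain _).aemeasurable
  -- Multiplying by a unit vector e turns f into a map of the space to itself, to which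
  -- `aemeasurable_fderivWithin` applies; pairing with e recovers the derivative of f. In dimension
  -- zero there is no such e.
  obtain ⟨e, he⟩ := exists_norm_eq (EuclideanSpace ℝ (Fin m)) zero_le_one
  set N := toMeasurable (volume : Measure (EuclideanSpace ℝ (Fin m)))
    {x | ¬ (x ∈ X → DifferentiableAt ℝ f x)}
  have hN : MeasurableSet N := measurableSet_toMeasurable _ _
  have hN0 : (volume : Measure (EuclideanSpace ℝ (Fin m))) N = 0 := by
    rw [measure_toMeasurable]; exact hf
  have hd : ∀ x ∈ X \ N, HasFDerivWithinAt (fun x => f x • e) ((fderiv ℝ f x).smulRight e)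
      (X \ N) x := by
    intro x hx
    have : DifferentiableAt ℝ f x := by
      by_contra h
      exact hx.2 (subset_toMeasurable _ _ fun h' => h (h' hx.1))
    exact (this.hasFDerivAt.smul_const e).hasFDerivWithinAt
  have h := aemeasurable_fderivWithin volume (hX.diff hN) hd
  rw [Measure.restrict_congr_set (sdiff_null_ae_eq_self hN0)] at h
  have h1 : fderiv ℝ f = fun x => (innerSL ℝ e).comp ((fderiv ℝ f x).smulRight e) := by
    ext x v
    simp [he]
  have h2 : Continuous fun L : EuclideanSpace ℝ (Fin m) →L[ℝ] EuclideanSpace ℝ (Fin m) =>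
      (InnerProductSpace.toDual ℝ (EuclideanSpace ℝ (Fin m))).symm ((innerSL ℝ e).comp L) := by
    fun_prop
  have h3 := h2.measurable.comp_aemeasurable h
  have h4 : ∇ f = fun x => (InnerProductSpace.toDual ℝ (EuclideanSpace ℝ (Fin m))).symm
      ((innerSL ℝ e).comp ((fderiv ℝ f x).smulRight e)) := by
    ext1 x
    rw [← congrFun h1 x]
    rfl
  rw [h4]
  exact h3

theorem IsAdmissible.aemeasurable_gradient (hρ : IsWeight X ρ) (hf : IsAdmissible X ρ f) :
    AEMeasurable (∇ f) (weightMeasure ρ) := by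
  refine (aemeasurable_gradient_restrict hρ.measurableSet hf.absCont.differentiable).mono_ac ?_
  intro s hs
  rw [measure_eq_zero_iff_ae_notMem] at hs ⊢
  exact (ae_weightMeasure_iff hρ).2 ((ae_restrict_iff' hρ.measurableSet).1 hs)

theorem IsAdmissible.integrable_sq_sum (hf : IsAdmissible X ρ f) (a : Fin m → ℝ) :
    Integrable (fun x => (∑ i, a i * (∇ f x) i) ^ 2) (weightMeasure ρ) ∧
      ∫ x, (∑ i, a i * (∇ f x) i) ^ 2 ∂(weightMeasure ρ) =
        a ⬝ᵥ (gradMatrix ρ f).mulVec a := by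
  have h : ∀ x, (∑ i, a i * (∇ f x) i) ^ 2 =
      ∑ i, ∑ k, a i * a k * ((∇ f x) i * (∇ f x) k) := by
    intro x
    rw [sq, Finset.sum_mul_sum]
    exact Finset.sum_congr rfl fun i _ => Finset.sum_congr rfl fun k _ => by ring
  have hi : ∀ i k, Integrable (fun x => a i * a k * ((∇ f x) i * (∇ f x) k)) (weightMeasure ρ) :=
    fun i k => (hf.integrable i k).const_mul _
  simp only [h]
  refine ⟨integrable_finsetSum _ fun i _ => integrable_finsetSum _ fun k _ => hi i k, ?_⟩
  rw [integral_finsetSum _ fun i _ => integrable_finsetSum _ fun k _ => hi i k]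
  simp only [dotProduct, Matrix.mulVec, gradMatrix, Matrix.of_apply, Finset.mul_sum]
  refine Finset.sum_congr rfl fun i _ => ?_
  rw [integral_finsetSum _ fun k _ => hi i k]
  refine Finset.sum_congr rfl fun k _ => ?_
  rw [integral_const_mul]
  ring

/-- This expresses 𝔼|W₂ᵀ∇f|² as the trace of W₂ᵀCW₂. -/
theorem IsAdmissible.lintegral_inactiveCoord_gradient (hf : IsAdmissible X ρ f)
    (W : Matrix (Fin m) (Fin m) ℝ) (n : ℕ) :
    ∫⁻ x, ‖inactiveCoord W n (∇ f x)‖ₑ ^ 2 ∂(weightMeasure ρ) =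
      ENNReal.ofReal (∑ j : InactiveIdx m n, W.col j ⬝ᵥ (gradMatrix ρ f).mulVec (W.col j)) := by
  have h : ∀ x, ‖inactiveCoord W n (∇ f x)‖ₑ ^ 2 =
      ENNReal.ofReal (∑ j : InactiveIdx m n, (∑ i, W.col j i * (∇ f x) i) ^ 2) := by
    intro x
    rw [← ofReal_norm, ← ENNReal.ofReal_pow (norm_nonneg _), EuclideanSpace.real_norm_sq_eq]
    rfl
  have hi : ∀ j : InactiveIdx m n,
      Integrable (fun x => (∑ i, W.col j i * (∇ f x) i) ^ 2) (weightMeasure ρ) :=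
    fun j => (hf.integrable_sq_sum (W.col j)).1
  simp only [h]
  rw [← ofReal_integral_eq_lintegral_ofReal (integrable_finsetSum _ fun j _ => hi j)
    (ae_of_all _ fun x => Finset.sum_nonneg fun j _ => sq_nonneg _),
    integral_finsetSum _ fun j _ => hi j]
  simp only [(hf.integrable_sq_sum _).2]

end Gradients

/-! ### Perturbed eigenspaces -/

section Perturbation

variable {m : ℕ} {C W W' : Matrix (Fin m) (Fin m) ℝ} {lam : Fin m → ℝ} {ε : ℝ} {n : ℕ}

theorem IsEigendecomposition.dotProduct_mulVec (h : IsEigendecomposition C W lam)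
    (a : Fin m → ℝ) : a ⬝ᵥ C.mulVec a = ∑ l, lam l * (W.transpose.mulVec a l) ^ 2 := by
  rw [h.eq, ← Matrix.mulVec_mulVec, ← Matrix.mulVec_mulVec, Matrix.dotProduct_mulVec,
    ← Matrix.mulVec_transpose]
  simp only [dotProduct, Matrix.mulVec_diagonal]
  exact Finset.sum_congr rfl fun l _ => by ring

theorem transpose_mulVec_col (hW : W ∈ Matrix.orthogonalGroup (Fin m) ℝ) (i j : Fin m) :
    W.transpose.mulVec (W.col j) i = if i = j then 1 else 0 := by
  have h : W.transpose * W = 1 := (Matrix.mem_orthogonalGroup_iff' _ _).1 hW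
  have h2 : (W.transpose * W) i j = W.transpose.mulVec (W.col j) i := rfl
  rw [← h2, h, Matrix.one_apply]

theorem IsEigendecomposition.eigenvalue_eq (h : IsEigendecomposition C W lam) (l : Fin m) :
    W.col l ⬝ᵥ C.mulVec (W.col l) = lam l := by
  rw [h.dotProduct_mulVec]
  simp [transpose_mulVec_col h.orthogonal]

theorem transpose_mulVec_col_comm (W W' : Matrix (Fin m) (Fin m) ℝ) (i j : Fin m) :
    W.transpose.mulVec (W'.col j) i = W'.transpose.mulVec (W.col i) j := by
  simp only [Matrix.mulVec, dotProduct, Matrix.transpose_apply, Matrix.col_apply, mul_comm]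

theorem sum_sq_transpose_mulVec (hW : W ∈ Matrix.orthogonalGroup (Fin m) ℝ) (v : Fin m → ℝ) :
    ∑ j, (W.transpose.mulVec v j) ^ 2 = ∑ i, v i ^ 2 := by
  have hT : W.transpose ∈ Matrix.orthogonalGroup (Fin m) ℝ := by
    rw [Matrix.mem_orthogonalGroup_iff, Matrix.transpose_transpose]
    exact (Matrix.mem_orthogonalGroup_iff' _ _).1 hW
  rw [← norm_mulVec_sq hT v, EuclideanSpace.real_norm_sq_eq]

theorem sum_inactive_sq_le (F : Fin m → ℝ) :
    ∑ j : InactiveIdx m n, F j ^ 2 ≤ ∑ j, F j ^ 2 := by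
  rw [← sum_active_add_sum_inactive n fun j => F j ^ 2]
  exact le_add_of_nonneg_left (Finset.sum_nonneg fun j _ => sq_nonneg _)

/-- A column of W - W' is the image of a unit basis vector, so the operator norm bounds its length.
-/
theorem IsPerturbation.sum_sq_sub_le (h : IsPerturbation W W' ε) (l : Fin m) :
    ∑ i, (W.col l i - W'.col l i) ^ 2 ≤ ε ^ 2 := by
  have h1 := (Matrix.toEuclideanCLM (𝕜 := ℝ) (W - W')).le_opNorm (EuclideanSpace.single l 1)
  rw [PiLp.norm_single, norm_one, mul_one] at h1
  have h2 := pow_le_pow_left₀ (norm_nonneg _) (h1.trans h.norm_le) 2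
  rw [EuclideanSpace.real_norm_sq_eq] at h2
  refine le_trans (le_of_eq (Finset.sum_congr rfl fun i _ => ?_)) h2
  congr 1
  have h3 : (Matrix.toEuclideanCLM (𝕜 := ℝ) (W - W') (EuclideanSpace.single l 1)).ofLp i =
      (W - W').mulVec (Pi.single l 1) i := rfl
  rw [h3, Matrix.mulVec_single_one]
  rfl

/-- The weight of λₗ is the squared length of the projection of wₗ onto the inactive columns of W'.
For active l, w'ₗ is orthogonal to these columns, so only wₗ - w'ₗ contributes; for inactive l the
weight is at most |wₗ|² = 1. -/
theorem IsPerturbation.sum_inactive_le (h : IsPerturbation W W' ε)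
    (hW : W ∈ Matrix.orthogonalGroup (Fin m) ℝ) (hdec : IsEigendecomposition C W lam)
    (hlam : ∀ l, 0 ≤ lam l) :
    ∑ j : InactiveIdx m n, W'.col j ⬝ᵥ C.mulVec (W'.col j) ≤
      ε ^ 2 * ∑ l : ActiveIdx m n, lam l + ∑ l : InactiveIdx m n, lam l := by
  have hact : ∀ l : ActiveIdx m n,
      ∑ j : InactiveIdx m n, (W'.transpose.mulVec (W.col l) j) ^ 2 ≤ ε ^ 2 := by
    intro l
    have h1 : ∀ j : InactiveIdx m n, W'.transpose.mulVec (W.col l) j =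
        W'.transpose.mulVec (W.col l - W'.col l) j := by
      intro j
      have hne : (j : Fin m) ≠ l := fun hjl =>
        absurd l.2 (not_lt.2 (hjl ▸ j.2))
      rw [Matrix.mulVec_sub, Pi.sub_apply, transpose_mulVec_col h.orthogonal, if_neg hne, sub_zero]
    simp only [h1]
    refine (sum_inactive_sq_le _).trans ?_
    rw [sum_sq_transpose_mulVec h.orthogonal]
    exact h.sum_sq_sub_le l
  have hinact : ∀ l : InactiveIdx m n,
      ∑ j : InactiveIdx m n, (W'.transpose.mulVec (W.col l) j) ^ 2 ≤ 1 := by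
    intro l
    refine (sum_inactive_sq_le _).trans (le_of_eq ?_)
    rw [sum_sq_transpose_mulVec h.orthogonal, ← sum_sq_transpose_mulVec hW]
    simp [transpose_mulVec_col hW]
  simp only [hdec.dotProduct_mulVec, transpose_mulVec_col_comm W W']
  rw [Finset.sum_comm, ← sum_active_add_sum_inactive n]
  refine add_le_add ?_ ?_
  · rw [Finset.mul_sum]
    refine Finset.sum_le_sum fun l _ => ?_
    rw [← Finset.mul_sum, mul_comm]
    exact mul_le_mul_of_nonneg_right (hact l) (hlam l)
  · refine Finset.sum_le_sum fun l _ => ?_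
    rw [← Finset.mul_sum]
    exact mul_le_of_le_one_right (hlam l) (hinact l)

end Perturbation

/-! ### The mean squared error of the Monte Carlo approximation -/

section Error

variable {m : ℕ} {X : Set (EuclideanSpace ℝ (Fin m))} {ρ f : EuclideanSpace ℝ (Fin m) → ℝ}
  {W : Matrix (Fin m) (Fin m) ℝ} {n N : ℕ}

theorem IsAdmissible.eigenvalue_nonneg (hf : IsAdmissible X ρ f) {lam : Fin m → ℝ}
    (h : IsEigendecomposition (gradMatrix ρ f) W lam) (l : Fin m) : 0 ≤ lam l := by
  rw [← h.eigenvalue_eq l, ← (hf.integrable_sq_sum (W.col l)).2]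
  exact integral_nonneg fun x => sq_nonneg _

theorem measurable_monteCarlo {g : EuclideanSpace ℝ (Fin m) → ℝ} (hg : Measurable g)
    (W : Matrix (Fin m) (Fin m) ℝ) (n N : ℕ) :
    Measurable fun p : EuclideanSpace ℝ (Fin m) × (Fin N → EuclideanSpace ℝ (InactiveIdx m n)) =>
      (g p.1 - monteCarlo W n N g p.1 p.2) ^ 2 := by
  have h1 : ∀ i : Fin N, Measurable fun p : EuclideanSpace ℝ (Fin m) ×
      (Fin N → EuclideanSpace ℝ (InactiveIdx m n)) =>
        fromCoords W n (activeCoord W n p.1) (p.2 i) := fun i =>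
    (continuous_fromCoords W n).measurable.comp
      (((continuous_activeCoord W n).measurable.comp measurable_fst).prodMk
        ((measurable_pi_apply i).comp measurable_snd))
  unfold monteCarlo
  exact ((hg.comp measurable_fst).sub ((Finset.measurable_fun_sum _ fun i _ =>
    hg.comp (h1 i)).const_mul _)).pow_const 2

theorem memLp_two_of_ae_eq {α E : Type*} [MeasurableSpace α] [NormedAddCommGroup E]
    [MeasurableSpace E] [BorelSpace E] [SecondCountableTopology E] {μ : Measure α} {g g' : α → E}
    (h : g =ᵐ[μ] g') (hg' : Measurable g') (hfin : ∫⁻ a, ‖g' a‖ₑ ^ 2 ∂μ < ∞) : MemLp g 2 μ := by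
  refine (memLp_congr_ae h).2 ⟨hg'.aestronglyMeasurable, ?_⟩
  rw [eLpNorm_lt_top_iff_lintegral_rpow_enorm_lt_top two_ne_zero ENNReal.ofNat_ne_top]
  simpa using hfin

/-- The admissible functions are admissible in the Poincaré inequality on almost every slice. -/
theorem IsAdmissible.slice (hρ : IsWeight X ρ) (hf : IsAdmissible X ρ f)
    (hW : W ∈ Matrix.orthogonalGroup (Fin m) ℝ) (n : ℕ) {G : EuclideanSpace ℝ (Fin m) →
      EuclideanSpace ℝ (Fin m)} (hG : Measurable G) (hGf : ∇ f =ᵐ[weightMeasure ρ] G) :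
    ∀ᵐ y : EuclideanSpace ℝ (ActiveIdx m n),
      IsAbsCont (fun z => f (fromCoords W n y z)) {z | fromCoords W n y z ∈ X} ∧
      MemLp (fun z => f (fromCoords W n y z)) 2 (condMeasure W n ρ y) ∧
      MemLp (∇ fun z => f (fromCoords W n y z)) 2 (condMeasure W n ρ y) ∧
      ∫⁻ z, ‖∇ (fun z => f (fromCoords W n y z)) z‖ₑ ^ 2 ∂(condMeasure W n ρ y) =
        ∫⁻ z, ‖inactiveCoord W n (G (fromCoords W n y z))‖ₑ ^ 2 ∂(condMeasure W n ρ y) := by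
  obtain ⟨f', hf'm, hff'⟩ := hf.memLp.1.aemeasurable
  have hfrom : ∀ y : EuclideanSpace ℝ (ActiveIdx m n), Measurable (fromCoords W n y) := fun y =>
    ((continuous_fromCoords W n).comp (Continuous.prodMk_right y)).measurable
  have hfin1 : ∫⁻ x, ‖f' x‖ₑ ^ 2 ∂(weightMeasure ρ) ≠ ∞ := by
    have h := ((memLp_congr_ae hff').1 hf.memLp).2
    rw [eLpNorm_lt_top_iff_lintegral_rpow_enorm_lt_top two_ne_zero ENNReal.ofNat_ne_top] at h
    simpa using h.ne
  have hfin2 : ∫⁻ x, ‖inactiveCoord W n (G x)‖ₑ ^ 2 ∂(weightMeasure ρ) ≠ ∞ := by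
    have h : ∫⁻ x, ‖inactiveCoord W n (G x)‖ₑ ^ 2 ∂(weightMeasure ρ) =
        ∫⁻ x, ‖inactiveCoord W n (∇ f x)‖ₑ ^ 2 ∂(weightMeasure ρ) := by
      refine lintegral_congr_ae ?_
      filter_upwards [hGf] with x hx
      rw [hx]
    rw [h, hf.lintegral_inactiveCoord_gradient]
    exact ENNReal.ofReal_ne_top
  have hGm : Measurable fun x => inactiveCoord W n (G x) :=
    (continuous_inactiveCoord W n).measurable.comp hG
  filter_upwards [hf.absCont.slice hW n, ae_ae_condMeasure hρ hW n hff',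
    ae_ae_condMeasure hρ hW n hGf,
    ae_lintegral_condMeasure_lt_top hρ hW n (hf'm.enorm.pow_const 2) hfin1,
    ae_lintegral_condMeasure_lt_top hρ hW n (hGm.enorm.pow_const 2) hfin2] with y h1 h2 h3 h4 h5
  have h6 : (∇ fun z => f (fromCoords W n y z)) =ᵐ[condMeasure W n ρ y]
      fun z => inactiveCoord W n (G (fromCoords W n y z)) := by
    filter_upwards [ae_condMeasure_of_ae hρ h1.2, h3] with z hz hz'
    rw [hz, hz']
  refine ⟨h1.1, memLp_two_of_ae_eq h2 (hf'm.comp (hfrom y)) h4,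
    memLp_two_of_ae_eq h6 (hGm.comp (hfrom y)) h5, lintegral_congr_ae ?_⟩
  filter_upwards [h6] with z hz
  rw [hz]

/-- The mean squared error of the Monte Carlo approximation, in terms of a constant that serves in
the Poincaré inequality on almost every slice. -/
theorem IsAdmissible.lintegral_sub_monteCarlo_le (hρ : IsWeight X ρ) (hf : IsAdmissible X ρ f)
    (hW : W ∈ Matrix.orthogonalGroup (Fin m) ℝ) (hN : 1 ≤ N) {c : ℝ≥0∞}
    (hc : ∀ᵐ y : EuclideanSpace ℝ (ActiveIdx m n),
      SatisfiesPoincare {z | fromCoords W n y z ∈ X} (condMeasure W n ρ y) c) :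
    AEStronglyMeasurable (fun p => (f p.1 - monteCarlo W n N f p.1 p.2) ^ 2)
        (sampleLaw W n N ρ) ∧
      ∫⁻ p, ‖(f p.1 - monteCarlo W n N f p.1 p.2) ^ 2‖ₑ ∂(sampleLaw W n N ρ) ≤
        c * (ENNReal.ofReal (1 + 1 / N) *
          ∫⁻ x, ‖inactiveCoord W n (∇ f x)‖ₑ ^ 2 ∂(weightMeasure ρ)) := by
  obtain ⟨f', hf'm, hff'⟩ := hf.memLp.1.aemeasurable
  obtain ⟨G, hG, hGf⟩ := hf.aemeasurable_gradient hρ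
  have hm := measurable_monteCarlo hf'm W n N
  have hae : (fun p => (f p.1 - monteCarlo W n N f p.1 p.2) ^ 2) =ᵐ[sampleLaw W n N ρ]
      fun p => (f' p.1 - monteCarlo W n N f' p.1 p.2) ^ 2 := by
    filter_upwards [ae_sampleLaw hρ hW n N hff'] with p hp
    simp only [monteCarlo, hp.1, hp.2]
  refine ⟨⟨_, hm.stronglyMeasurable, hae⟩, ?_⟩
  have hGm : Measurable fun x => ‖inactiveCoord W n (G x)‖ₑ ^ 2 :=
    ((continuous_inactiveCoord W n).measurable.comp hG).enorm.pow_const 2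
  calc ∫⁻ p, ‖(f p.1 - monteCarlo W n N f p.1 p.2) ^ 2‖ₑ ∂(sampleLaw W n N ρ)
      = ∫⁻ p, ‖(f' p.1 - monteCarlo W n N f' p.1 p.2) ^ 2‖ₑ ∂(sampleLaw W n N ρ) := by
        refine lintegral_congr_ae ?_
        filter_upwards [hae] with p hp
        rw [hp]
    _ ≤ ∫⁻ y, c * (ENNReal.ofReal (1 + 1 / N) * (marginalDensity W n ρ y *
          ∫⁻ z, ‖inactiveCoord W n (G (fromCoords W n y z))‖ₑ ^ 2 ∂(condMeasure W n ρ y))) := by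
        rw [lintegral_sampleLaw hρ hW n N hm.enorm]
        refine lintegral_mono_ae ?_
        filter_upwards [hc, hf.slice hρ hW n hG hGf, ae_ae_condMeasure hρ hW n hff',
          ae_marginalDensity_ne_top hρ hW n] with y hcy hy hff'y htop
        -- Here the conditional measure is not a probability measure, but such y carry no weight.
        by_cases h0 : marginalDensity W n ρ y = 0
        · simp [h0]
        have hprob := isProbabilityMeasure_condMeasure hρ.measurable h0 htop
        have h1 := lintegral_sub_sampleMean_sq ((memLp_congr_ae hff'y).1 hy.2.1) hN
        have h2 := hcy _ hy.1 hy.2.1 hy.2.2.1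
        rw [hy.2.2.2, evariance_congr hff'y] at h2
        simp only [monteCarlo, activeCoord_fromCoords hW]
        rw [h1]
        calc _ ≤ marginalDensity W n ρ y * (ENNReal.ofReal (1 + 1 / N) * (c *
              ∫⁻ z, ‖inactiveCoord W n (G (fromCoords W n y z))‖ₑ ^ 2 ∂(condMeasure W n ρ y))) :=
              mul_le_mul_right (mul_le_mul_right h2 _) _
          _ = _ := by ring
    _ = c * (ENNReal.ofReal (1 + 1 / N) *
          ∫⁻ x, ‖inactiveCoord W n (∇ f x)‖ₑ ^ 2 ∂(weightMeasure ρ)) := by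
        have hmeas : Measurable fun y => marginalDensity W n ρ y *
            ∫⁻ z, ‖inactiveCoord W n (G (fromCoords W n y z))‖ₑ ^ 2 ∂(condMeasure W n ρ y) :=
          (measurable_marginalDensity hρ.measurable W n).mul
            (measurable_lintegral_condMeasure hρ.measurable W n hGm)
        rw [lintegral_const_mul _ (hmeas.const_mul _), lintegral_const_mul _ hmeas,
          ← lintegral_weightMeasure hρ hW n hGm]
        congr 2
        refine lintegral_congr_ae ?_
        filter_upwards [hGf] with x hx
        rw [hx]

theorem add_le_sq_add_sqrt {a b ε : ℝ} (ha : 0 ≤ a) (hb : 0 ≤ b) (hε : 0 ≤ ε) :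
    ε ^ 2 * a + b ≤ (ε * √a + √b) ^ 2 := by
  have h : 0 ≤ ε * √a * √b := by positivity
  nlinarith [Real.sq_sqrt ha, Real.sq_sqrt hb]

theorem IsAdmissible.monteCarlo_error (hρ : IsWeight X ρ) (hC : poincareConstant X ρ ≠ ∞)
    (hf : IsAdmissible X ρ f) {lam : Fin m → ℝ}
    (hdec : IsEigendecomposition (gradMatrix ρ f) W lam) {W' : Matrix (Fin m) (Fin m) ℝ} {ε : ℝ}
    (hε : 0 < ε) (hW' : IsPerturbation W W' ε) (hn : n < m) (hN : 1 ≤ N) :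
    Integrable (fun p => (f p.1 - monteCarlo W' n N f p.1 p.2) ^ 2) (sampleLaw W' n N ρ) ∧
      ∫ p, (f p.1 - monteCarlo W' n N f p.1 p.2) ^ 2 ∂(sampleLaw W' n N ρ) ≤
        (poincareConstant X ρ).toReal * (1 + 1 / (N : ℝ)) *
          (ε * √(∑ i : ActiveIdx m n, lam i) + √(∑ i : InactiveIdx m n, lam i)) ^ 2 := by
  have hlam := hf.eigenvalue_nonneg hdec
  set B := (ε * √(∑ i : ActiveIdx m n, lam i) + √(∑ i : InactiveIdx m n, lam i)) ^ 2
  have hB : ∑ j : InactiveIdx m n, W'.col j ⬝ᵥ (gradMatrix ρ f).mulVec (W'.col j) ≤ B :=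
    (hW'.sum_inactive_le hdec.orthogonal hdec hlam).trans (add_le_sq_add_sqrt
      (Finset.sum_nonneg fun l _ => hlam l) (Finset.sum_nonneg fun l _ => hlam l) hε.le)
  set K := ENNReal.ofReal ((1 + 1 / (N : ℝ)) * B) with hK
  have hmain : ∀ c : ℝ≥0∞, (∀ n < m, ∀ W ∈ Matrix.orthogonalGroup (Fin m) ℝ,
      ∀ᵐ y : EuclideanSpace ℝ (ActiveIdx m n),
        SatisfiesPoincare {z | fromCoords W n y z ∈ X} (condMeasure W n ρ y) c) →
      AEStronglyMeasurable (fun p => (f p.1 - monteCarlo W' n N f p.1 p.2) ^ 2)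
        (sampleLaw W' n N ρ) ∧
      ∫⁻ p, ‖(f p.1 - monteCarlo W' n N f p.1 p.2) ^ 2‖ₑ ∂(sampleLaw W' n N ρ) ≤ c * K := by
    intro c hc
    have h := hf.lintegral_sub_monteCarlo_le hρ hW'.orthogonal hN (hc n hn W' hW'.orthogonal)
    refine ⟨h.1, h.2.trans (mul_le_mul_right ?_ _)⟩
    rw [hf.lintegral_inactiveCoord_gradient, hK, ENNReal.ofReal_mul (by positivity)]
    exact mul_le_mul_right (ENNReal.ofReal_le_ofReal hB) _
  -- The infimum of the empty set is ∞, so finiteness of the Poincaré constant yields at least one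
  -- valid constant.
  obtain ⟨c₀, hc₀⟩ : ∃ c : ℝ≥0∞, ∀ n < m, ∀ W ∈ Matrix.orthogonalGroup (Fin m) ℝ,
      ∀ᵐ y : EuclideanSpace ℝ (ActiveIdx m n),
        SatisfiesPoincare {z | fromCoords W n y z ∈ X} (condMeasure W n ρ y) c := by
    by_contra h
    refine hC (top_le_iff.1 (le_sInf fun c hc => ?_))
    exact absurd ⟨c, hc⟩ h
  have hle : ∫⁻ p, ‖(f p.1 - monteCarlo W' n N f p.1 p.2) ^ 2‖ₑ ∂(sampleLaw W' n N ρ) ≤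
      poincareConstant X ρ * K := by
    -- The infimum is not known to be attained, so the bound is divided by `K` and passed to the
    -- infimum. When `K` = 0 any single constant already gives error 0.
    by_cases hK0 : K = 0
    · simpa [hK0] using (hmain c₀ hc₀).2
    · rw [← ENNReal.div_le_iff hK0 ENNReal.ofReal_ne_top]
      refine le_sInf fun c hc => ?_
      rw [ENNReal.div_le_iff hK0 ENNReal.ofReal_ne_top]
      exact (hmain c hc).2
  have htop : poincareConstant X ρ * K ≠ ∞ := ENNReal.mul_ne_top hC ENNReal.ofReal_ne_top
  refine ⟨⟨(hmain c₀ hc₀).1, hle.trans_lt htop.lt_top⟩, ?_⟩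
  rw [integral_eq_lintegral_of_nonneg_ae (ae_of_all _ fun p => sq_nonneg _) (hmain c₀ hc₀).1,
    mul_assoc]
  have h := ENNReal.toReal_mono htop hle
  rw [ENNReal.toReal_mul, hK, ENNReal.toReal_ofReal (by positivity)] at h
  simpa only [Real.enorm_of_nonneg (sq_nonneg _)] using h

end Error

end ActiveSubspace

end

open ActiveSubspace in
theorem mainTheorem5 {m : ℕ} (X : Set (EuclideanSpace ℝ (Fin m)))
    (ρ : EuclideanSpace ℝ (Fin m) → ℝ) (hρ : IsWeight X ρ) :
    (poincareConstant X ρ ≠ ∞ →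
      ∀ f : EuclideanSpace ℝ (Fin m) → ℝ, IsAdmissible X ρ f →
      ∀ (W : Matrix (Fin m) (Fin m) ℝ) (lam : Fin m → ℝ),
        IsEigendecomposition (gradMatrix ρ f) W lam →
      ∀ (W' : Matrix (Fin m) (Fin m) ℝ) (ε : ℝ), 0 < ε → IsPerturbation W W' ε →
      ∀ n N : ℕ, n < m → 1 ≤ N →
        Integrable (fun p => (f p.1 - monteCarlo W' n N f p.1 p.2) ^ 2) (sampleLaw W' n N ρ) ∧
        ∫ p, (f p.1 - monteCarlo W' n N f p.1 p.2) ^ 2 ∂(sampleLaw W' n N ρ) ≤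
          (poincareConstant X ρ).toReal * (1 + 1 / (N : ℝ)) *
            (ε * √(∑ i : ActiveIdx m n, lam i) + √(∑ i : InactiveIdx m n, lam i)) ^ 2) ∧
    (((Convex ℝ X ∧ Bornology.IsBounded X ∧ ∃ c : ℝ, 0 < c ∧ ∀ x ∈ X, c ≤ ρ x) ∨
      (X = Set.univ ∧ ∃ κ c₁ c₂ : ℝ, 0 < κ ∧ 0 < c₁ ∧
        ∀ x, c₁ * Real.exp (-κ * ‖x‖ ^ 2) ≤ ρ x ∧ ρ x ≤ c₂ * Real.exp (-κ * ‖x‖ ^ 2))) →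
      poincareConstant X ρ ≠ ∞) := by
  refine ⟨fun hC f hf W lam hdec W' ε hε hW' n N hn hN =>
    hf.monteCarlo_error hρ hC hdec hε hW' hn hN, ?_⟩
  rintro (⟨hX, hb, c, hc, hcρ⟩ | ⟨rfl, κ, c₁, c₂, hκ, hc₁, h⟩)
  · exact hρ.poincareConstant_ne_top_of_convex hX hb hc hcρ
  · exact hρ.poincareConstant_ne_top_of_gaussian hκ hc₁ h
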